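/- Let $0<m<n$ be integers, $\rho=\frac{n-1}{2}$, $\rho'=\frac{m-1}{2}$. Let $G=\{g\in O(1,n):g_{11}>0\}$ be the isometry group of hyperbolic $n$-space, $H_0=E_{12}+E_{21}$, $A=\exp(\mathbb{R}H_0)$, $M=\mathrm{diag}(1,1,O(n-1))$, $N=\exp(\mathrm{span}\{N_j\})$ with $N_j=E_{1,j+2}+E_{2,j+2}+E_{j+2,1}-E_{j+2,2}$, and $\overline n_x=\exp(\sum_j x_j\overline N_j)$ for $x\in\mathbb{R}^{n-1}$, with $\overline N_j=E_{1,j+2}-E_{2,j+2}+E_{j+2,1}+E_{j+2,2}$. For $\nu\in\mathbb{C}$ let $$I(\nu)=\{f\in C^\infty(G): f(gme^{tH_0}n)=e^{-(\nu+\rho)t}f(g)\ \ \forall g\in G,\,m\in M,\,t\in\mathbb{R},\,n\in N\},$$ let $J(\nu)$ be the space of all functions $x\mapsto f(\overline n_x)$ on $\mathbb{R}^{n-1}$ with $f\in I(\nu)$, and let $\psi_\nu(x)=(1+|x|^2)^{-(\nu+\rho)}$ be its spherical vector. Let $J'(\nu')$, $\psi'_{\nu'}(y)=(1+|y|^2)^{-(\nu'+\rho')}$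 be the analogous objects for $m$ in place of $n$; these are functions on $\mathbb{R}^{m-1}$. Write $x=(x',x'')\in\mathbb{R}^{m-1}\times\mathbb{R}^{n-m}$. For $\Re\nu-\rho\ge\Re\nu'-\rho'\ge0$ put $$\ell_{\nu,\nu'}(f_1,f_2)=\int_{\mathbb{R}^{n-1}}\int_{\mathbb{R}^{m-1}}(|x'-y|^2+|x''|^2)^{\nu'-\rho'}|x''|^{(\nu-\rho)-(\nu'-\rho')}f_1(x)f_2(y)\,dy\,dx ,\qquad f_1\in J(\nu),\ f_2\in J'(\nu').$$ For other parameters, $\ell_{\nu,\nu'}(f_1,f_2)$ is the value at $(\mu,\mu')=(\nu,\nu')$ of the meromorphic continuation to $\mathbb{C}^2$ of $$(\mu,\mu')\mapsto\ell_{\mu,\mu'}\big((1+|x|^2)^{\nu-\mu}f_1,\ (1+|y|^2)^{\nu'-\mu'}f_2\big)$$ (the vectors are moved to $J(\mu)$, $J'(\mu')$ with their restrictions to the maximal compact subgroups fixed). Then, as meromorphic functions of $(\nu,\nu')\in\mathbb{C}^2$, $$\ell_{\nu,\nu'}(\psi_\nu,\psi'_{\nu'})=\frac{\pi^{\rho+\rho'}\,\Gamma(\rho')\,\Gamma\big(\tfrac{(\nu+\rho)+(\nu'-\rho')}{2}\big)\,\Gamma\big(\tfrac{(\nu+\rho)-(\nu'+\rho')}{2}\big)}{\Gamma(2\rho')\,\Gamma(\rho-\rho')\,\Gamma(\nu+\rho)},$$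 where for $m=1$ (so that $\rho'=0$, $\mathbb{R}^{m-1}$ is a point, and the integration over $y$ is evaluation at it) the quotient $\Gamma(\rho')/\Gamma(2\rho')$ has to be read as $1$. More precisely, for $\Re\nu-\rho\ge\Re\nu'-\rho'\ge0$ the integral for $(\psi_\nu,\psi'_{\nu'})$ converges absolutely and has this value; both sides are meromorphic on $\mathbb{C}^2$; and they agree at every $(\nu,\nu')$ with $\nu+\rho+\nu'-\rho'\notin-2\mathbb{N}_0$ and $\nu+\rho-\nu'-\rho'\notin-2\mathbb{N}_0$. In particular, if $\nu\in i\mathbb{R}\cup(-\rho,\rho)$, $\nu'\in i\mathbb{R}\cup(-\rho',\rho')$, $\nu+\rho+\nu'-\rho'\notin-2\mathbb{N}_0$ and $\nu+\rho-\nu'-\rho'\notin-2\mathbb{N}_0$, then $\ell_{\nu,\nu'}$ is non-trivial: there are $f_1\in J(\nu)$, $f_2\in J'(\nu')$ with $\ell_{\nu,\nu'}(f_1,f_2)\ne0$. -/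

import Mathlib

open scoped ContDiff Topology

namespace ModelForm

/-- Half the sum of the positive roots of the isometry group of hyperbolic `n`-space. -/
noncomputable def rho (n : ℕ) : ℝ := ((n : ℝ) - 1) / 2

/-! ### The group and its principal series

Hyperbolic space of dimension `n = card ι + 1`; the coordinates `x₁, x₂` of the Lorentzian space
`ℝ^{n+1}` are `Sum.inl 0`, `Sum.inl 1`, and `x_{j+2}` is `Sum.inr j`. -/

/-- Real matrices of size `n + 1`, where `n = card ι + 1`. -/
abbrev Mat (ι : Type) : Type := Matrix (Fin 2 ⊕ ι) (Fin 2 ⊕ ι) ℝ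

section Group

variable {ι : Type} [Fintype ι] [DecidableEq ι]

/-- The Gram matrix of `Q(x) = -x₁² + x₂² + ⋯ + x_{n+1}²`. -/
def lorentz (ι : Type) [DecidableEq ι] : Mat ι :=
  Matrix.diagonal (Sum.elim ![-1, 1] (fun _ => 1))

/-- The group `G = Isom(ℍⁿ)`: all `g ∈ O(1,n)` with `(g e₁)₁ > 0`. -/
def isomGroup (ι : Type) [Fintype ι] [DecidableEq ι] : Set (Mat ι) :=
  {g | g.transpose * lorentz ι * g = lorentz ι ∧ 0 < g (Sum.inl 0) (Sum.inl 0)}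

/-- The generator `H₀ = E₁₂ + E₂₁` of `𝔞`. -/
def H0 (ι : Type) [DecidableEq ι] : Mat ι :=
  Matrix.single (Sum.inl 0) (Sum.inl 1) 1 + Matrix.single (Sum.inl 1) (Sum.inl 0) 1

/-- The root vector `N_j = E_{1,j+2} + E_{2,j+2} + E_{j+2,1} - E_{j+2,2}` of `𝔫`. -/
def rootN (j : ι) : Mat ι :=
  Matrix.single (Sum.inl 0) (Sum.inr j) 1 + Matrix.single (Sum.inl 1) (Sum.inr j) 1
    + Matrix.single (Sum.inr j) (Sum.inl 0) 1 - Matrix.single (Sum.inr j) (Sum.inl 1) 1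

/-- The root vector `N̄_j = E_{1,j+2} - E_{2,j+2} + E_{j+2,1} + E_{j+2,2}` of `𝔫̄`. -/
def rootNbar (j : ι) : Mat ι :=
  Matrix.single (Sum.inl 0) (Sum.inr j) 1 - Matrix.single (Sum.inl 1) (Sum.inr j) 1
    + Matrix.single (Sum.inr j) (Sum.inl 0) 1 + Matrix.single (Sum.inr j) (Sum.inl 1) 1

/-- The element `exp(t H₀)` of `A`. -/
noncomputable def aExp (ι : Type) [Fintype ι] [DecidableEq ι] (t : ℝ) : Mat ι :=
  NormedSpace.exp (t • H0 ι)

/-- The element `n_x = exp(∑ x_j N_j)` of `N`. -/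
noncomputable def nExp (x : EuclideanSpace ℝ ι) : Mat ι :=
  NormedSpace.exp (∑ j, x j • rootN j)

/-- The element `n̄_x = exp(∑ x_j N̄_j)` of `N̄`. -/
noncomputable def nbarExp (x : EuclideanSpace ℝ ι) : Mat ι :=
  NormedSpace.exp (∑ j, x j • rootNbar j)

/-- The element `diag(1, 1, k)` of `M`, where `k ∈ O(n-1)`. -/
def mDiag (k : Matrix.orthogonalGroup ι ℝ) : Mat ι :=
  Matrix.fromBlocks 1 0 0 (k : Matrix ι ι ℝ)

/-- The principal series `I(ν)`: smooth functions on `G` with `f(g m a n) = a^{-ν-ρ} f(g)`.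
A function on `G` is represented by a function on all matrices, whose values outside `G` play
no role; `G` is an embedded submanifold of the space of matrices (here the space of arrays of
entries, which carries a norm), so that `ContDiffOn` on `G` is smoothness on `G`. -/
def inducedRep (ι : Type) [Fintype ι] [DecidableEq ι] (ν : ℂ) : Set (Mat ι → ℂ) :=
  {f | ContDiffOn ℝ ∞ (fun e : Fin 2 ⊕ ι → Fin 2 ⊕ ι → ℝ => f (Matrix.of e))
      {e | Matrix.of e ∈ isomGroup ι} ∧
    ∀ g ∈ isomGroup ι, ∀ (k : Matrix.orthogonalGroup ι ℝ) (t : ℝ) (x : EuclideanSpace ℝ ι),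
      f (g * mDiag k * aExp ι t * nExp x)
        = Complex.exp (-(ν + rho (Fintype.card ι + 1)) * t) * f g}

/-- The non-compact picture `J(ν)` of `I(ν)`: the functions `x ↦ f(n̄_x)` with `f ∈ I(ν)`. -/
def flatRep (ι : Type) [Fintype ι] [DecidableEq ι] (ν : ℂ) : Set (EuclideanSpace ℝ ι → ℂ) :=
  {φ | ∃ f ∈ inducedRep ι ν, ∀ x, φ x = f (nbarExp x)}

end Group

/-- The spherical vector `ψ_ν(x) = (1 + |x|²)^{-(ν+ρ)}` of `J(ν)`. -/
noncomputable def spherical (ι : Type) [Fintype ι] (ν : ℂ) (x : EuclideanSpace ℝ ι) : ℂ :=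
  ((1 + ‖x‖ ^ 2 : ℝ) : ℂ) ^ (-(ν + rho (Fintype.card ι + 1)))

/-- For `f ∈ J(ν)` this is the element of `J(μ)` which, as a function on `G`, has the same
restriction to the maximal compact subgroup `K` (as the Iwasawa projection of `n̄_x` is
`log(1 + |x|²) H₀`). -/
noncomputable def flatSection {ι : Type} [Fintype ι] (ν : ℂ) (f : EuclideanSpace ℝ ι → ℂ) (μ : ℂ)
    (x : EuclideanSpace ℝ ι) : ℂ :=
  ((1 + ‖x‖ ^ 2 : ℝ) : ℂ) ^ (ν - μ) * f x

/-! ### Meromorphic functions of two variables -/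

/-- `Φ` is meromorphic on `ℂ²`: locally it is a quotient of two analytic functions, the
denominator not vanishing identically near any point. The values of `Φ` on the zero set of the
denominator play no role. -/
def IsMeromorphic (Φ : ℂ × ℂ → ℂ) : Prop :=
  ∀ p : ℂ × ℂ, ∃ a b : ℂ × ℂ → ℂ, AnalyticAt ℂ a p ∧ AnalyticAt ℂ b p ∧
    (∃ᶠ q in 𝓝 p, b q ≠ 0) ∧ ∀ᶠ q in 𝓝 p, b q ≠ 0 → Φ q = a q / b q

/-! ### The model bilinear form

`ℝ^{n-1} = ℝ^{m-1} × ℝ^{n-m}` has the coordinates `ι ⊕ κ` with `ι = Fin (m-1)` and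
`κ = Fin (n-m)`; we write `x = (x', x'')`. -/

section Form

variable {ι κ : Type} [Fintype ι] [Fintype κ]

/-- The component `x'` of `x = (x', x'')`. -/
def fstPart (x : EuclideanSpace ℝ (ι ⊕ κ)) : EuclideanSpace ℝ ι :=
  WithLp.toLp 2 (fun i => x (Sum.inl i))

/-- The component `x''` of `x = (x', x'')`. -/
def sndPart (x : EuclideanSpace ℝ (ι ⊕ κ)) : EuclideanSpace ℝ κ :=
  WithLp.toLp 2 (fun j => x (Sum.inr j))

/-- The integrand
`(|x'-y|² + |x''|²)^{ν'-ρ'} |x''|^{(ν-ρ)-(ν'-ρ')} f₁(x) f₂(y)`. -/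
noncomputable def modelIntegrand (ν ν' : ℂ) (f₁ : EuclideanSpace ℝ (ι ⊕ κ) → ℂ)
    (f₂ : EuclideanSpace ℝ ι → ℂ) (x : EuclideanSpace ℝ (ι ⊕ κ)) (y : EuclideanSpace ℝ ι) : ℂ :=
  ((‖fstPart x - y‖ ^ 2 + ‖sndPart x‖ ^ 2 : ℝ) : ℂ) ^ (ν' - rho (Fintype.card ι + 1))
    * ((‖sndPart x‖ : ℝ) : ℂ) ^
        ((ν - rho (Fintype.card (ι ⊕ κ) + 1)) - (ν' - rho (Fintype.card ι + 1)))
    * f₁ x * f₂ y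

/-- The integral which defines the model form for `Re ν - ρ ≥ Re ν' - ρ' ≥ 0`. -/
noncomputable def modelIntegral (ν ν' : ℂ) (f₁ : EuclideanSpace ℝ (ι ⊕ κ) → ℂ)
    (f₂ : EuclideanSpace ℝ ι → ℂ) : ℂ :=
  ∫ x : EuclideanSpace ℝ (ι ⊕ κ), ∫ y : EuclideanSpace ℝ ι, modelIntegrand ν ν' f₁ f₂ x y

/-- The set of all `(ν, ν')` with `Re ν - ρ ≥ Re ν' - ρ' ≥ 0`. -/
def convRegion (ι κ : Type) [Fintype ι] [Fintype κ] : Set (ℂ × ℂ) :=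
  {p | p.1.re - rho (Fintype.card (ι ⊕ κ) + 1) ≥ p.2.re - rho (Fintype.card ι + 1) ∧
    p.2.re - rho (Fintype.card ι + 1) ≥ 0}

/-- For `f₁ ∈ J(ν)`, `f₂ ∈ J'(ν')`: `Φ` is a meromorphic continuation to `ℂ²` of the integral as
a function of its parameters `(μ, μ')`, where `f₁`, `f₂` are carried to `J(μ)`, `J'(μ')` with
their restrictions to the maximal compact subgroups fixed. -/
def IsContinuation (ν ν' : ℂ) (f₁ : EuclideanSpace ℝ (ι ⊕ κ) → ℂ) (f₂ : EuclideanSpace ℝ ι → ℂ)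
    (Φ : ℂ × ℂ → ℂ) : Prop :=
  IsMeromorphic Φ ∧ ∀ p ∈ convRegion ι κ,
    Φ p = modelIntegral p.1 p.2 (flatSection ν f₁ p.1) (flatSection ν' f₂ p.2)

open Classical in
/-- The model form `ℓ_{ν,ν'}(f₁, f₂)` on `J(ν) × J'(ν')`, for arbitrary complex `(ν, ν')`: the
value at `(ν, ν')` of the meromorphic continuation of the integral. By the identity theorem it
does not depend on the chosen `Φ`. At a singularity of the continuation the value is `0`. -/
noncomputable def modelForm (ν ν' : ℂ) (f₁ : EuclideanSpace ℝ (ι ⊕ κ) → ℂ)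
    (f₂ : EuclideanSpace ℝ ι → ℂ) : ℂ :=
  if h : ∃ Φ : ℂ × ℂ → ℂ, IsContinuation ν ν' f₁ f₂ Φ ∧ AnalyticAt ℂ Φ (ν, ν') then
    h.choose (ν, ν')
  else 0

end Form

/-! ### Parameters and the special value -/

/-- `ν ∈ iℝ ∪ (-r, r)`. -/
def IsUnitaryParam (r : ℝ) (ν : ℂ) : Prop :=
  ν.re = 0 ∨ (ν.im = 0 ∧ -r < ν.re ∧ ν.re < r)

/-- `ν + ρ ± ν' - ρ' ∉ -2ℕ₀`. -/
def IsRegular (n m : ℕ) (ν ν' : ℂ) : Prop :=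
  ∀ k : ℕ, ν + rho n + ν' - rho m ≠ -(2 * k) ∧ ν + rho n - ν' - rho m ≠ -(2 * k)

/-- The quotient `Γ(ρ') / Γ(2ρ')`. For `m = 1`, that is `ρ' = 0`, both Gamma factors have a pole,
the integration over `y` is evaluation at the point `ℝ⁰`, and the factor is `1`. -/
noncomputable def gammaQuotient (m : ℕ) : ℂ :=
  if m = 1 then 1 else Complex.Gamma (rho m) / Complex.Gamma (2 * rho m)

/-- `π^{ρ+ρ'} Γ(ρ') Γ((ν+ρ+ν'-ρ')/2) Γ((ν+ρ-ν'-ρ')/2) / (Γ(2ρ') Γ(ρ-ρ') Γ(ν+ρ))`. -/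
noncomputable def specialValue (n m : ℕ) (ν ν' : ℂ) : ℂ :=
  (Real.pi : ℂ) ^ ((rho n : ℂ) + rho m) * gammaQuotient m
    * Complex.Gamma (((ν + rho n) + (ν' - rho m)) / 2)
    * Complex.Gamma (((ν + rho n) - (ν' + rho m)) / 2)
    / (Complex.Gamma ((rho n : ℂ) - rho m) * Complex.Gamma (ν + rho n))

end ModelForm

/-! Fix `y` and integrate over `x` first. With `a = ν' - ρ'`, `b = (ν - ρ) - (ν' - ρ')` and `s = ν +
ρ`, the kernel against the spherical vector is `|x - (y,0)|^(2a) |x''|^b (1 + |x|²)^(-s)`, and `a +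
b + (n - 1) = s`. Apply the inversion centred at `(y,0)` with radius `√(1 + |y|²)`. On the upper
half space this sphere passes through the base point at height 1, so `1 + |x|²` and `|x''|` are both
multiplied by the conformal factor `t`, the distance term becomes `(1 + |y|²) t`, and the Jacobian
is `t^(n-1)`. By the relation between the exponents every power of `t` cancels, and only the factor
`(1 + |y|²)^a` depends on `y` (`sphericalKernel_inversion`).

The double integral is therefore a product. The `y`-integral is that of `(1 + |y|²)^(-2ρ')`, which
is independent of the parameters (`integral_japanese_self`). The `x`-integral of `|x''|^b (1 +
|x|²)^(-s)` reduces, by rescaling `x'` and polar coordinates in `x''`, to Beta integrals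
(`integral_weighted_japanese`). Absolute values factor in the same way, which gives Fubini.

Outside the region of convergence the formula follows from the identity theorem for local quotients
of analytic functions (`IsMeromorphic.eq_of_eqOn`), since the explicit value is a quotient of entire
functions built from `1/Γ`. Non-triviality holds because the spherical vectors lie in the
representation spaces and the special value has no zero at the parameters considered. -/

namespace ModelForm

/-! ### Meromorphic functions on `ℂ²` and the identity theorem. -/

open Set Filter

/-- An analytic function near `p` which is frequently nonzero at `p` is nonzero on a dense subset
of a neighbourhood of `p`. -/
lemma exists_ball_dense_ne_zero {b : ℂ × ℂ → ℂ} {p : ℂ × ℂ} (hb : AnalyticAt ℂ b p)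
    (hf : ∃ᶠ q in 𝓝 p, b q ≠ 0) {U : Set (ℂ × ℂ)} (hU : U ∈ 𝓝 p) :
    ∃ r > 0, Metric.ball p r ⊆ U ∧ AnalyticOnNhd ℂ b (Metric.ball p r) ∧
      ∀ V : Set (ℂ × ℂ), IsOpen V → (V ∩ Metric.ball p r).Nonempty →
        ∃ q ∈ V ∩ Metric.ball p r, b q ≠ 0 := by
  obtain ⟨r, hr, h⟩ := Metric.eventually_nhds_iff_ball.1 (hb.eventually_analyticAt.and hU)
  refine ⟨r, hr, fun q hq => (h q hq).2, fun q hq => (h q hq).1, ?_⟩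
  rintro V hV ⟨q₀, hq₀V, hq₀⟩
  by_contra! hcon
  have han : AnalyticOnNhd ℂ b (Metric.ball p r) := fun q hq => (h q hq).1
  have hev : b =ᶠ[𝓝 q₀] 0 := by
    filter_upwards [(hV.inter Metric.isOpen_ball).mem_nhds ⟨hq₀V, hq₀⟩] with q hq
    exact hcon q hq
  have hz := han.eqOn_zero_of_preconnected_of_eventuallyEq_zero
    (convex_ball p r).isPreconnected hq₀ hev
  refine hf ?_
  filter_upwards [Metric.ball_mem_nhds p hr] with q hq
  simpa using hz hq

/-- The difference of two meromorphic functions is meromorphic. -/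
lemma IsMeromorphic.sub {Φ Ψ : ℂ × ℂ → ℂ} (hΦ : IsMeromorphic Φ) (hΨ : IsMeromorphic Ψ) :
    IsMeromorphic (fun p => Φ p - Ψ p) := by
  intro p
  obtain ⟨a, b, ha, hb, hbf, hab⟩ := hΦ p
  obtain ⟨c, d, hc, hd, hdf, hcd⟩ := hΨ p
  refine ⟨fun q => a q * d q - b q * c q, fun q => b q * d q,
    (ha.mul hd).sub (hb.mul hc), hb.mul hd, ?_, ?_⟩
  · rw [Filter.frequently_iff]
    intro U hU
    obtain ⟨r, hr, hrU, han, hdense⟩ := exists_ball_dense_ne_zero hb hbf hU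
    obtain ⟨t, ht, htU, -, hdense'⟩ :=
      exists_ball_dense_ne_zero hd hdf (Metric.ball_mem_nhds p hr)
    -- A point with `b ≠ 0` keeps this property on a neighbourhood, and that neighbourhood contains
    -- a point with `d ≠ 0`.
    obtain ⟨q, ⟨hq, hqr⟩, hbq⟩ := hdense (Metric.ball p t) Metric.isOpen_ball
      ⟨p, Metric.mem_ball_self ht, Metric.mem_ball_self hr⟩
    have hopen : {x ∈ Metric.ball p r | b x ∈ ({0}ᶜ : Set ℂ)} ∈ 𝓝 q :=
      Filter.inter_mem (Metric.isOpen_ball.mem_nhds hqr)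
        ((han q hqr).continuousAt.preimage_mem_nhds (isOpen_compl_singleton.mem_nhds hbq))
    obtain ⟨V, hV, hVo, hqV⟩ := mem_nhds_iff.1 hopen
    obtain ⟨x, ⟨hxV, hx⟩, hdx⟩ := hdense' V hVo ⟨q, hqV, hq⟩
    exact ⟨x, hrU (htU hx), mul_ne_zero (hV hxV).2 hdx⟩
  · filter_upwards [hab, hcd] with q h1 h2 h3
    have hbq : b q ≠ 0 := left_ne_zero_of_mul h3
    have hdq : d q ≠ 0 := right_ne_zero_of_mul h3
    rw [h1 hbq, h2 hdq]
    field_simp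

/-- If a meromorphic function vanishes on a nonempty open set, its zero set has dense interior. -/
lemma IsMeromorphic.closure_interior_eq_univ {D : ℂ × ℂ → ℂ} (hD : IsMeromorphic D)
    (hne : (interior {p | D p = 0}).Nonempty) : closure (interior {p | D p = 0}) = univ := by
  -- Connectedness argument. Near a point of the closure the numerator vanishes on an open set,
  -- hence on a whole ball, so `D` vanishes wherever `b ≠ 0`, which is dense in the ball.
  have hopen : IsOpen (closure (interior {p | D p = 0})) := by
    rw [isOpen_iff_mem_nhds]
    intro p hp
    obtain ⟨a, b, ha, hb, hbf, hab⟩ := hD p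
    obtain ⟨r, hr, hrU, han, hdense⟩ :=
      exists_ball_dense_ne_zero hb hbf (ha.eventually_analyticAt.and hab)
    have hane : AnalyticOnNhd ℂ a (Metric.ball p r) := fun q hq => (hrU hq).1
    have ha0 : EqOn a 0 (Metric.ball p r) := by
      obtain ⟨q, hq, hbq⟩ := hdense (interior {p | D p = 0}) isOpen_interior (by
        obtain ⟨x, hx, hx'⟩ := mem_closure_iff.1 hp _ Metric.isOpen_ball (Metric.mem_ball_self hr)
        exact ⟨x, hx', hx⟩)
      refine hane.eqOn_zero_of_preconnected_of_eventuallyEq_zero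
        (convex_ball p r).isPreconnected hq.2 ?_
      filter_upwards [isOpen_interior.mem_nhds hq.1, Metric.isOpen_ball.mem_nhds hq.2,
        (han q hq.2).continuousAt.eventually_ne hbq] with x hx hxb hx0
      have h0 : x ∈ {p | D p = 0} := interior_subset hx
      rw [mem_ofPred_eq] at h0
      have h1 := (hrU hxb).2 hx0
      rw [h0, eq_comm, div_eq_zero_iff] at h1
      simpa using h1.resolve_right hx0
    refine Filter.mem_of_superset (Metric.ball_mem_nhds p hr) fun q hq => ?_
    rw [mem_closure_iff]
    intro V hV hqV
    obtain ⟨x, hx, hbx⟩ := hdense V hV ⟨q, hqV, hq⟩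
    refine ⟨x, hx.1, mem_interior_iff_mem_nhds.2 ?_⟩
    filter_upwards [Metric.isOpen_ball.mem_nhds hx.2,
      (han x hx.2).continuousAt.eventually_ne hbx] with y hy hby
    have h1 := (hrU hy).2 hby
    rw [ha0 hy] at h1
    simpa using h1
  exact IsClopen.eq_univ ⟨isClosed_closure, hopen⟩ hne.closure

/-- The identity theorem for meromorphic functions of two variables. -/
lemma IsMeromorphic.eq_of_eqOn {Φ Ψ : ℂ × ℂ → ℂ} (hΦ : IsMeromorphic Φ) (hΨ : IsMeromorphic Ψ)
    {S : Set (ℂ × ℂ)} (hS : (interior S).Nonempty) (h : EqOn Φ Ψ S) {p : ℂ × ℂ}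
    (hp : ContinuousAt Φ p) (hp' : ContinuousAt Ψ p) : Φ p = Ψ p := by
  have hcl := (hΦ.sub hΨ).closure_interior_eq_univ
    (hS.mono (interior_mono fun q hq => sub_eq_zero.2 (h hq)))
  -- A meromorphic function may take arbitrary values where its denominator vanishes, so the dense
  -- equality reaches `p` only through continuity there.
  have hmem : p ∈ closure {p | Φ p - Ψ p = 0} :=
    closure_mono interior_subset (hcl ▸ mem_univ p)
  have := mem_closure_image (f := fun q => Φ q - Ψ q) (hp.sub hp') hmem
  have h0 : (fun q => Φ q - Ψ q) '' {p | Φ p - Ψ p = 0} ⊆ {0} := by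
    rintro _ ⟨q, hq, rfl⟩
    exact hq
  have h1 := closure_mono h0 this
  rw [closure_singleton] at h1
  exact sub_eq_zero.1 h1

/-! ### The model form at spherical vectors. -/

variable {ι κ : Type} [Fintype ι] [Fintype κ]

lemma interior_convRegion_nonempty : (interior (convRegion ι κ)).Nonempty := by
  refine ⟨(((rho (Fintype.card (ι ⊕ κ) + 1) + 2 : ℝ) : ℂ),
    ((rho (Fintype.card ι + 1) + 1 : ℝ) : ℂ)), mem_interior.2
    ⟨{p : ℂ × ℂ | p.1.re - rho (Fintype.card (ι ⊕ κ) + 1) > p.2.re - rho (Fintype.card ι + 1) ∧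
      p.2.re - rho (Fintype.card ι + 1) > 0}, fun p hp => ⟨hp.1.le, hp.2.le⟩, ?_, ?_⟩⟩
  · exact IsOpen.inter
      (isOpen_lt ((Complex.continuous_re.comp continuous_snd).sub continuous_const)
        ((Complex.continuous_re.comp continuous_fst).sub continuous_const))
      (isOpen_lt continuous_const
        ((Complex.continuous_re.comp continuous_snd).sub continuous_const))
  · constructor
    · simp only [Complex.ofReal_re]; linarith
    · simp only [Complex.ofReal_re]; linarith

/-- Spherical vectors restrict to the constant 1 on the maximal compact subgroup. Hence the
continuation problem does not depend on the base point `(ν, ν')`, and a single function solves it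
for all of them. -/
lemma flatSection_spherical (ν μ : ℂ) :
    flatSection ν (spherical ι ν) μ = spherical ι μ := by
  ext x
  have h : ((1 + ‖x‖ ^ 2 : ℝ) : ℂ) ≠ 0 := by
    rw [Complex.ofReal_ne_zero]; positivity
  rw [flatSection, spherical, spherical, ← Complex.cpow_add _ _ h]
  congr 1
  ring

lemma isContinuation_spherical_iff {Ψ : ℂ × ℂ → ℂ} {ν ν' : ℂ} :
    IsContinuation ν ν' (spherical (ι ⊕ κ) ν) (spherical ι ν') Ψ ↔
      IsMeromorphic Ψ ∧ ∀ p ∈ convRegion ι κ,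
        Ψ p = modelIntegral p.1 p.2 (spherical (ι ⊕ κ) p.1) (spherical ι p.2) := by
  simp only [IsContinuation, flatSection_spherical]

/-- The model form at the spherical vectors is the value of any meromorphic continuation of the
integral which is analytic at the point. -/
lemma modelForm_spherical_eq {Ψ : ℂ × ℂ → ℂ} (hΨ : IsMeromorphic Ψ)
    (h : ∀ p ∈ convRegion ι κ,
      modelIntegral p.1 p.2 (spherical (ι ⊕ κ) p.1) (spherical ι p.2) = Ψ p)
    {ν ν' : ℂ} (ha : AnalyticAt ℂ Ψ (ν, ν')) :
    modelForm ν ν' (spherical (ι ⊕ κ) ν) (spherical ι ν') = Ψ (ν, ν') := by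
  have hex : ∃ Φ : ℂ × ℂ → ℂ, IsContinuation ν ν' (spherical (ι ⊕ κ) ν) (spherical ι ν') Φ ∧
      AnalyticAt ℂ Φ (ν, ν') :=
    ⟨Ψ, isContinuation_spherical_iff.2 ⟨hΨ, fun p hp => (h p hp).symm⟩, ha⟩
  rw [modelForm, dif_pos hex]
  obtain ⟨hc, hca⟩ := hex.choose_spec
  rw [isContinuation_spherical_iff] at hc
  exact hc.1.eq_of_eqOn hΨ (interior_convRegion_nonempty (ι := ι) (κ := κ))
    (fun p hp => (hc.2 p hp).trans (h p hp)) hca.continuousAt ha.continuousAt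

/-! ### The special value -/

/-- The common denominator of the two Gamma factors in the numerator of the special value. -/
noncomputable def gammaDenom (n m : ℕ) (p : ℂ × ℂ) : ℂ :=
  (Complex.Gamma (((p.1 + rho n) + (p.2 - rho m)) / 2))⁻¹ *
    (Complex.Gamma (((p.1 + rho n) - (p.2 + rho m)) / 2))⁻¹

/-- The special value without the two Gamma factors in the numerator. -/
noncomputable def gammaNum (n m : ℕ) (p : ℂ × ℂ) : ℂ :=
  (Real.pi : ℂ) ^ ((rho n : ℂ) + rho m) * gammaQuotient m
    * (Complex.Gamma ((rho n : ℂ) - rho m))⁻¹ * (Complex.Gamma (p.1 + rho n))⁻¹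

/-- Since `1/Γ` is entire, this is a quotient of entire functions. It also holds at the poles: there
Lean's `Γ` is 0, and both sides are 0. -/
lemma specialValue_eq_div (n m : ℕ) (p : ℂ × ℂ) :
    specialValue n m p.1 p.2 = gammaNum n m p / gammaDenom n m p := by
  simp only [specialValue, gammaNum, gammaDenom, div_eq_mul_inv, mul_inv, inv_inv]
  ring

lemma analyticAt_inv_Gamma_comp {f : ℂ × ℂ → ℂ} {p : ℂ × ℂ} (hf : AnalyticAt ℂ f p) :
    AnalyticAt ℂ (fun q => (Complex.Gamma (f q))⁻¹) p :=
  have h : AnalyticAt ℂ (fun s => (Complex.Gamma s)⁻¹) (f p) :=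
    Complex.differentiable_one_div_Gamma.analyticAt _
  h.comp hf

lemma analyticAt_gammaDenom (n m : ℕ) (p : ℂ × ℂ) : AnalyticAt ℂ (gammaDenom n m) p :=
  (analyticAt_inv_Gamma_comp (((analyticAt_fst.add analyticAt_const).add
    (analyticAt_snd.sub analyticAt_const)).div analyticAt_const two_ne_zero)).mul
  (analyticAt_inv_Gamma_comp (((analyticAt_fst.add analyticAt_const).sub
    (analyticAt_snd.add analyticAt_const)).div analyticAt_const two_ne_zero))

lemma analyticAt_gammaNum (n m : ℕ) (p : ℂ × ℂ) : AnalyticAt ℂ (gammaNum n m) p :=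
  analyticAt_const.mul (analyticAt_inv_Gamma_comp (analyticAt_fst.add analyticAt_const))

lemma gammaDenom_ne_zero_iff (n m : ℕ) (ν ν' : ℂ) :
    gammaDenom n m (ν, ν') ≠ 0 ↔ IsRegular n m ν ν' := by
  rw [gammaDenom, mul_ne_zero_iff, Ne, Ne, inv_eq_zero, inv_eq_zero,
    Complex.Gamma_eq_zero_iff, Complex.Gamma_eq_zero_iff, IsRegular, not_exists, not_exists,
    ← forall_and]
  refine forall_congr' fun k => and_congr (not_congr ?_) (not_congr ?_)
  · rw [div_eq_iff two_ne_zero]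
    constructor <;> intro h <;> linear_combination h
  · rw [div_eq_iff two_ne_zero]
    constructor <;> intro h <;> linear_combination h

lemma frequently_gammaDenom_ne_zero (n m : ℕ) (p : ℂ × ℂ) :
    ∃ᶠ q in 𝓝 p, gammaDenom n m q ≠ 0 := by
  intro hcon
  have hz := AnalyticOnNhd.eq_of_eventuallyEq (f := gammaDenom n m) (g := fun _ => 0)
    (fun q _ => analyticAt_gammaDenom n m q) (fun q _ => analyticAt_const) (z₀ := p)
    (hcon.mono fun q hq => not_not.1 hq)
  -- At this point both `ν + ρ + ν' - ρ'` and `ν + ρ - ν' - ρ'` equal 1.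
  refine (gammaDenom_ne_zero_iff n m (1 + rho m - rho n) 0).2 (fun k => ?_) (congrFun hz _)
  have key : (1 : ℂ) ≠ -(2 * k) := fun h => by
    have := congrArg Complex.re h
    simp at this
    have hk : (0 : ℝ) ≤ k := k.cast_nonneg
    linarith
  constructor
  · convert key using 1; ring
  · convert key using 1; ring

/-- The denominator is nonzero exactly at regular parameters, so values elsewhere are irrelevant.
This lets `modelForm`, with its default value 0, count as meromorphic. -/
lemma isMeromorphic_of_eq_specialValue {n m : ℕ} {Φ : ℂ × ℂ → ℂ}
    (h : ∀ ν ν', IsRegular n m ν ν' → Φ (ν, ν') = specialValue n m ν ν') : IsMeromorphic Φ :=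
  fun p => ⟨gammaNum n m, gammaDenom n m, analyticAt_gammaNum n m p, analyticAt_gammaDenom n m p,
    frequently_gammaDenom_ne_zero n m p, Eventually.of_forall fun q hq => by
      rw [← specialValue_eq_div]
      exact h q.1 q.2 ((gammaDenom_ne_zero_iff n m q.1 q.2).1 hq)⟩

lemma isMeromorphic_specialValue (n m : ℕ) :
    IsMeromorphic (fun p : ℂ × ℂ => specialValue n m p.1 p.2) :=
  isMeromorphic_of_eq_specialValue fun _ _ _ => rfl

lemma analyticAt_specialValue {n m : ℕ} {ν ν' : ℂ} (h : IsRegular n m ν ν') :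
    AnalyticAt ℂ (fun p : ℂ × ℂ => specialValue n m p.1 p.2) (ν, ν') := by
  simp only [specialValue_eq_div]
  exact (analyticAt_gammaNum n m _).div (analyticAt_gammaDenom n m _)
    ((gammaDenom_ne_zero_iff n m ν ν').2 h)

/-- `Γ` has no zeros, so a zero could come only from a pole of `Γ(ν + ρ)` or `Γ(ρ - ρ')`. Both
arguments have positive real part. -/
lemma specialValue_ne_zero {n m : ℕ} (hm : 0 < m) (hmn : m < n) {ν ν' : ℂ}
    (hν : IsUnitaryParam (rho n) ν) (h : IsRegular n m ν ν') : specialValue n m ν ν' ≠ 0 := by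
  have hmn' : (m : ℝ) < n := by exact_mod_cast hmn
  have hm' : (1 : ℝ) ≤ m := by exact_mod_cast hm
  have hpos : 0 < (ν + rho n).re := by
    have hn : 0 < rho n := by unfold rho; linarith
    rw [Complex.add_re, Complex.ofReal_re]
    rcases hν with h | h
    · rw [h]; linarith
    · linarith [h.2.1]
  have hpos' : 0 < ((rho n : ℂ) - rho m).re := by
    rw [Complex.sub_re, Complex.ofReal_re, Complex.ofReal_re]; unfold rho; linarith
  have hq : gammaQuotient m ≠ 0 := by
    unfold gammaQuotient
    split_ifs with h1
    · exact one_ne_zero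
    · have h2 : (2 : ℝ) ≤ m := by exact_mod_cast (show 2 ≤ m by omega)
      have h3 : 0 < rho m := by unfold rho; linarith
      refine div_ne_zero (Complex.Gamma_ne_zero_of_re_pos (by simpa using h3))
        (Complex.Gamma_ne_zero_of_re_pos (by simpa using h3))
  have := specialValue_eq_div n m (ν, ν')
  simp only at this
  rw [this]
  refine div_ne_zero ?_ ((gammaDenom_ne_zero_iff n m ν ν').2 h)
  unfold gammaNum
  refine mul_ne_zero (mul_ne_zero (mul_ne_zero ?_ hq) ?_) ?_
  · rw [Complex.cpow_def_of_ne_zero (by exact_mod_cast Real.pi_ne_zero)]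
    exact Complex.exp_ne_zero _
  · exact inv_ne_zero (Complex.Gamma_ne_zero_of_re_pos hpos')
  · exact inv_ne_zero (Complex.Gamma_ne_zero_of_re_pos hpos)

end ModelForm

/-! ### The spherical vector as a function on the group. -/

namespace ModelForm

open Matrix

section Group

variable {ι : Type} [Fintype ι] [DecidableEq ι]

open scoped Norms.Operator in
/-- The exponential series of a matrix applied to a vector. -/
lemma hasSum_exp_mulVec {ι : Type} [Fintype ι] [DecidableEq ι] (X : Matrix ι ι ℝ) (v : ι → ℝ) :
    HasSum (fun k : ℕ => (k.factorial : ℝ)⁻¹ • (X ^ k *ᵥ v)) (NormedSpace.exp X *ᵥ v) := by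
  have h := NormedSpace.exp_series_hasSum_exp' (𝕂 := ℝ) X
  have h2 := h.mapL (LinearMap.toContinuousLinearMap
    ((Matrix.mulVecBilin ℝ ℝ).flip v : Matrix ι ι ℝ →ₗ[ℝ] (ι → ℝ)))
  simp at h2
  exact h2

/-- The exponential of a matrix acts on an eigenvector by the exponential of the eigenvalue. -/
lemma exp_mulVec_of_eigenvector {ι : Type} [Fintype ι] [DecidableEq ι] {X : Matrix ι ι ℝ}
    {v : ι → ℝ} {c : ℝ} (h : X *ᵥ v = c • v) : NormedSpace.exp X *ᵥ v = Real.exp c • v := by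
  have hpow : ∀ k : ℕ, X ^ k *ᵥ v = c ^ k • v := by
    intro k
    induction k with
    | zero => simp
    | succ k ih =>
      rw [pow_succ, ← mulVec_mulVec, h, mulVec_smul, ih, smul_smul, pow_succ, mul_comm]
  refine (hasSum_exp_mulVec X v).unique ?_
  have h1 := (NormedSpace.exp_series_hasSum_exp' (𝕂 := ℝ) c).smul_const v
  rw [← Real.exp_eq_exp_ℝ] at h1
  simpa [hpow, smul_smul] using h1

/-- The vector `e₁ + e₂`, an eigenvector of `MAN`. -/
def lightVector (ι : Type) : Fin 2 ⊕ ι → ℝ := Sum.elim (fun _ => 1) (fun _ => 0)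

lemma H0_mulVec_lightVector : H0 ι *ᵥ lightVector ι = lightVector ι := by
  ext i
  rcases i with i | i
  · fin_cases i <;> simp [H0, lightVector, add_mulVec, single_mulVec]
  · simp [H0, lightVector, add_mulVec, single_mulVec]

lemma aExp_mulVec_lightVector (t : ℝ) :
    aExp ι t *ᵥ lightVector ι = Real.exp t • lightVector ι :=
  exp_mulVec_of_eigenvector (by rw [smul_mulVec, H0_mulVec_lightVector])

lemma sum_rootN_mulVec_lightVector (x : EuclideanSpace ℝ ι) :
    (∑ j, x j • rootN j) *ᵥ lightVector ι = 0 := by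
  rw [sum_mulVec]
  refine Finset.sum_eq_zero fun j _ => ?_
  rw [smul_mulVec]
  convert smul_zero _
  ext i
  rcases i with i | i
  · fin_cases i <;> simp [rootN, lightVector, add_mulVec, sub_mulVec, single_mulVec]
  · simp [rootN, lightVector, add_mulVec, sub_mulVec, single_mulVec]

lemma nExp_mulVec_lightVector (x : EuclideanSpace ℝ ι) :
    nExp x *ᵥ lightVector ι = lightVector ι := by
  have := exp_mulVec_of_eigenvector (X := ∑ j, x j • rootN j) (v := lightVector ι) (c := 0)
    (by rw [sum_rootN_mulVec_lightVector, zero_smul])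
  rwa [Real.exp_zero, one_smul] at this

lemma mDiag_mulVec_lightVector (k : Matrix.orthogonalGroup ι ℝ) :
    mDiag k *ᵥ lightVector ι = lightVector ι := by
  rw [mDiag, lightVector, fromBlocks_mulVec]
  ext i
  rcases i with i | i
  · simp [Function.comp_def]
  · simp [Function.comp_def, mulVec, dotProduct]

lemma sum_rootNbar_mulVec (x : EuclideanSpace ℝ ι) (w : Fin 2 ⊕ ι → ℝ) :
    (∑ j, x j • rootNbar j) *ᵥ w = Sum.elim
      (fun i => ![1, -1] i * ∑ j, x j * w (Sum.inr j))
      (fun j => x j * (w (Sum.inl 0) + w (Sum.inl 1))) := by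
  rw [sum_mulVec]
  ext i
  rw [Finset.sum_apply]
  rcases i with i | i
  · rw [Sum.elim_inl, Finset.mul_sum]
    refine Finset.sum_congr rfl fun j _ => ?_
    fin_cases i <;> simp [rootNbar, smul_mulVec, add_mulVec, sub_mulVec, single_mulVec]
  · simp [rootNbar, smul_mulVec, add_mulVec, sub_mulVec, single_mulVec, Function.update_apply,
      Finset.sum_ite_eq, mul_add, Finset.sum_add_distrib]

/-- The exponent is nilpotent on `e₁ + e₂`: its cube kills the vector, and the quadratic term
contributes `2‖x‖² / 2` to the first coordinate. -/
lemma nbarExp_mulVec_lightVector (x : EuclideanSpace ℝ ι) :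
    (nbarExp x *ᵥ lightVector ι) (Sum.inl 0) = 1 + ‖x‖ ^ 2 := by
  set X := ∑ j, x j • rootNbar j with hX
  have h1 : X *ᵥ lightVector ι = Sum.elim (fun _ => 0) (fun j => 2 * x j) := by
    rw [hX, sum_rootNbar_mulVec]
    ext i
    rcases i with i | i
    · simp [lightVector]
    · simp [lightVector]; ring
  have h2 : X ^ 2 *ᵥ lightVector ι = Sum.elim (fun i => ![1, -1] i * (2 * ‖x‖ ^ 2))
      (fun _ => 0) := by
    rw [pow_two, ← mulVec_mulVec, h1, hX, sum_rootNbar_mulVec]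
    ext i
    rcases i with i | i
    · rw [Sum.elim_inl, Sum.elim_inl, EuclideanSpace.norm_sq_eq]
      congr 1
      rw [Finset.mul_sum]
      refine Finset.sum_congr rfl fun j _ => ?_
      rw [Sum.elim_inr, Real.norm_eq_abs, sq_abs]; ring
    · simp
  have h3 : ∀ k, X ^ (3 + k) *ᵥ lightVector ι = 0 := by
    intro k
    rw [show 3 + k = k + 1 + 2 by ring, pow_add, pow_succ, ← mulVec_mulVec, ← mulVec_mulVec, h2, hX,
      sum_rootNbar_mulVec]
    refine Eq.trans (congrArg _ (funext fun i => ?_)) (mulVec_zero (X ^ k))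
    rcases i with i | i <;> simp
  have h4 := (hasSum_exp_mulVec X (lightVector ι)).unique
    (hasSum_sum_of_ne_finset_zero (s := Finset.range 3) fun k (hk : k ∉ Finset.range 3) => by
      obtain ⟨l, rfl⟩ := Nat.exists_eq_add_of_le (not_lt.1 (fun hlt => hk (Finset.mem_range.2 hlt)))
      rw [h3, smul_zero])
  rw [nbarExp, ← hX, h4]
  simp [Finset.sum_range_succ, h1, h2]
  simp [lightVector]

lemma mulVec_lightVector {ι : Type} [Fintype ι] (g : Mat ι) :
    (g *ᵥ lightVector ι) (Sum.inl 0) = g (Sum.inl 0) (Sum.inl 0) + g (Sum.inl 0) (Sum.inl 1) := by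
  simp [mulVec, dotProduct, lightVector]

/-- The group is closed under transposition of the defining relation, so the first row satisfies
`g₁₁² = 1 + g₁₂² + ⋯`. Thus `|g₁₂| < g₁₁`. Positivity keeps the complex power in `groupSpherical`
away from its branch cut. -/
lemma isomGroup_pos {g : Mat ι} (hg : g ∈ isomGroup ι) :
    0 < g (Sum.inl 0) (Sum.inl 0) + g (Sum.inl 0) (Sum.inl 1) := by
  obtain ⟨h, h0⟩ := hg
  have hL : lorentz ι * lorentz ι = 1 := by
    rw [lorentz, diagonal_mul_diagonal, ← diagonal_one]
    congr 1
    ext i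
    rcases i with i | i
    · fin_cases i <;> simp
    · simp
  have h1 : (lorentz ι * gᵀ * lorentz ι) * g = 1 := by
    rw [Matrix.mul_assoc, Matrix.mul_assoc, ← Matrix.mul_assoc gᵀ, h, hL]
  have h2 := mul_eq_one_comm.1 h1
  have h3 : g * lorentz ι * gᵀ = lorentz ι := by
    calc g * lorentz ι * gᵀ = g * lorentz ι * gᵀ * (lorentz ι * lorentz ι) := by
          rw [hL, Matrix.mul_one]
      _ = (g * (lorentz ι * gᵀ * lorentz ι)) * lorentz ι := by simp only [Matrix.mul_assoc]
      _ = lorentz ι := by rw [h2, Matrix.one_mul]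
  have h4 := congrFun (congrFun h3 (Sum.inl 0)) (Sum.inl 0)
  rw [Matrix.mul_apply] at h4
  simp [lorentz] at h4
  have h5 : 0 ≤ ∑ j, g (Sum.inl 0) (Sum.inr j) * g (Sum.inl 0) (Sum.inr j) :=
    Finset.sum_nonneg fun j _ => mul_self_nonneg _
  nlinarith

/-- The spherical vector of `I(ν)`. -/
noncomputable def groupSpherical (ι : Type) [Fintype ι] (ν : ℂ) (g : Mat ι) : ℂ :=
  (((g (Sum.inl 0) (Sum.inl 0) + g (Sum.inl 0) (Sum.inl 1) : ℝ)) : ℂ) ^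
    (-(ν + rho (Fintype.card ι + 1)))

lemma groupSpherical_mem (ν : ℂ) : groupSpherical ι ν ∈ inducedRep ι ν := by
  constructor
  · intro e he
    have hpos := isomGroup_pos he
    refine ContDiffAt.contDiffWithinAt ?_
    -- Near a point of the group the base is positive, so the power equals `exp (log · exponent)`,
    -- which is visibly smooth in the matrix entries.
    have hlog : ContDiffAt ℝ ∞ (fun e : Fin 2 ⊕ ι → Fin 2 ⊕ ι → ℝ =>
        Complex.exp (((Real.log (e (Sum.inl 0) (Sum.inl 0) + e (Sum.inl 0) (Sum.inl 1)) : ℝ) : ℂ) *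
          (-(ν + rho (Fintype.card ι + 1))))) e := by
      refine ContDiffAt.cexp (ContDiffAt.mul ?_ contDiffAt_const)
      refine Complex.ofRealCLM.contDiff.contDiffAt.comp e (ContDiffAt.log ?_ hpos.ne')
      fun_prop
    refine hlog.congr_of_eventuallyEq ?_
    have hev : ∀ᶠ e' in 𝓝 e, 0 < (e' (Sum.inl 0) (Sum.inl 0) + e' (Sum.inl 0) (Sum.inl 1) : ℝ) :=
      (isOpen_lt continuous_const (by fun_prop)).mem_nhds hpos
    filter_upwards [hev] with e' he'
    rw [groupSpherical, Complex.cpow_def_of_ne_zero (by exact_mod_cast he'.ne'),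
      Complex.ofReal_log he'.le]
    rfl
  · intro g hg k t x
    have hpos := isomGroup_pos hg
    -- `M` and `N` fix `e₁ + e₂` and `exp(t H₀)` scales it by `e^t`, which yields the required
    -- equivariance.
    have key : ((g * mDiag k * aExp ι t * nExp x) *ᵥ lightVector ι) (Sum.inl 0)
        = Real.exp t * (g *ᵥ lightVector ι) (Sum.inl 0) := by
      rw [← mulVec_mulVec, nExp_mulVec_lightVector, ← mulVec_mulVec, aExp_mulVec_lightVector,
        mulVec_smul, ← mulVec_mulVec, mDiag_mulVec_lightVector, Pi.smul_apply, smul_eq_mul]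
    rw [mulVec_lightVector, mulVec_lightVector] at key
    rw [groupSpherical, key, Complex.ofReal_mul, Complex.mul_cpow_ofReal_nonneg
      (Real.exp_pos t).le hpos.le, groupSpherical, Complex.ofReal_exp,
      Complex.cpow_def_of_ne_zero (Complex.exp_ne_zero _), ← Complex.ofReal_exp,
      ← Complex.ofReal_log (Real.exp_pos t).le, Real.log_exp, mul_comm (t : ℂ)]

lemma spherical_mem_flatRep (ν : ℂ) : spherical ι ν ∈ flatRep ι ν := by
  refine ⟨groupSpherical ι ν, groupSpherical_mem ν, fun x => ?_⟩
  rw [spherical, groupSpherical, ← mulVec_lightVector, nbarExp_mulVec_lightVector]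

end Group

end ModelForm

/-! ### Beta integrals and powers of `1 + |x|²`. -/

namespace ModelForm

open MeasureTheory Set

section BetaIntegral

lemma image_sq_div_one_add_sq :
    (fun r : ℝ => r ^ 2 / (1 + r ^ 2)) '' Ioi 0 = Ioo 0 1 := by
  ext x
  constructor
  · rintro ⟨r, hr, rfl⟩
    have hr' : (0 : ℝ) < r := hr
    refine ⟨by positivity, ?_⟩
    rw [div_lt_one (by positivity)]
    linarith
  · rintro ⟨h0, h1⟩
    have h2 : 0 < 1 - x := by linarith
    refine ⟨√(x / (1 - x)), Real.sqrt_pos.2 (by positivity), ?_⟩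
    simp only
    rw [Real.sq_sqrt (by positivity)]
    field_simp
    ring

lemma injOn_sq_div_one_add_sq : InjOn (fun r : ℝ => r ^ 2 / (1 + r ^ 2)) (Ioi 0) := by
  intro r hr t ht h
  have hr' : (0 : ℝ) < r := hr
  have ht' : (0 : ℝ) < t := ht
  simp only at h
  rw [div_eq_div_iff (by positivity) (by positivity)] at h
  exact (pow_left_inj₀ hr'.le ht'.le two_ne_zero).1 (by linarith)

lemma hasDerivAt_sq_div_one_add_sq (r : ℝ) :
    HasDerivAt (fun r : ℝ => r ^ 2 / (1 + r ^ 2)) (2 * r / (1 + r ^ 2) ^ 2) r := by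
  have h : HasDerivAt (fun r : ℝ => r ^ 2) (2 * r) r := by simpa using hasDerivAt_pow 2 r
  refine (h.fun_div (h.const_add 1) (by positivity)).congr_deriv ?_
  ring

/-- The substitution `x = r² / (1 + r²)` maps `(0, ∞)` onto `(0, 1)` and turns `1 - x` into `(1 +
r²)⁻¹`; the left side is the Beta integrand times the Jacobian. -/
lemma beta_integrand_comp {r : ℝ} (hr : 0 < r) (u v : ℂ) :
    |2 * r / (1 + r ^ 2) ^ 2| • (((r ^ 2 / (1 + r ^ 2) : ℝ) : ℂ) ^ (u - 1) *
      (1 - ((r ^ 2 / (1 + r ^ 2) : ℝ) : ℂ)) ^ (v - 1))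
      = 2 * ((r : ℂ) ^ (2 * u - 1) * ((1 + r ^ 2 : ℝ) : ℂ) ^ (-(u + v))) := by
  have hA : 0 < 1 + r ^ 2 := by positivity
  have h1 : (1 - ((r ^ 2 / (1 + r ^ 2) : ℝ) : ℂ)) = (((1 + r ^ 2)⁻¹ : ℝ) : ℂ) := by
    rw [← Complex.ofReal_one, ← Complex.ofReal_sub]
    congr 1
    field_simp
    ring
  have hAc : ((1 + r ^ 2 : ℝ) : ℂ) ≠ 0 := by exact_mod_cast hA.ne'
  have hrc : (r : ℂ) ≠ 0 := by exact_mod_cast hr.ne'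
  have hinv : ∀ w : ℂ, (((1 + r ^ 2)⁻¹ : ℝ) : ℂ) ^ w = ((1 + r ^ 2 : ℝ) : ℂ) ^ (-w) := by
    intro w
    rw [Complex.ofReal_inv, Complex.inv_cpow, Complex.cpow_neg]
    rw [Complex.arg_ofReal_of_nonneg hA.le]
    exact Real.pi_pos.ne
  have h2 : ((1 + r ^ 2 : ℝ) : ℂ) ^ (-2 : ℂ) = (((1 + r ^ 2 : ℝ) : ℂ) ^ 2)⁻¹ := by
    rw [Complex.cpow_neg, Complex.cpow_ofNat]
  rw [h1, abs_of_pos (by positivity), div_eq_mul_inv (r ^ 2), Complex.ofReal_mul,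
    Complex.mul_cpow_ofReal_nonneg (by positivity) (by positivity), hinv, hinv, pow_two r,
    Complex.ofReal_mul r r, Complex.mul_cpow_ofReal_nonneg hr.le hr.le, ← Complex.cpow_add _ _ hrc,
    Complex.real_smul, ← pow_two r, Complex.ofReal_div, Complex.ofReal_mul, Complex.ofReal_pow,
    show -(u + v) = -(u - 1) + -(v - 1) + (-2 : ℂ) by ring,
    Complex.cpow_add _ _ hAc, Complex.cpow_add _ _ hAc, h2,
    show 2 * u - 1 = (u - 1) + (u - 1) + 1 by ring, Complex.cpow_add _ 1 hrc, Complex.cpow_one]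
  push_cast
  ring

/-- The Beta integral over the half line. -/
lemma beta_halfLine {u v : ℂ} (hu : 0 < u.re) (hv : 0 < v.re) :
    IntegrableOn (fun r : ℝ => (r : ℂ) ^ (2 * u - 1) * ((1 + r ^ 2 : ℝ) : ℂ) ^ (-(u + v))) (Ioi 0) ∧
    ∫ r in Ioi (0 : ℝ), (r : ℂ) ^ (2 * u - 1) * ((1 + r ^ 2 : ℝ) : ℂ) ^ (-(u + v))
      = Complex.Gamma u * Complex.Gamma v / (2 * Complex.Gamma (u + v)) := by
  have hder : ∀ r ∈ Ioi (0 : ℝ), HasDerivWithinAt (fun r : ℝ => r ^ 2 / (1 + r ^ 2))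
      (2 * r / (1 + r ^ 2) ^ 2) (Ioi 0) r :=
    fun r _ => (hasDerivAt_sq_div_one_add_sq r).hasDerivWithinAt
  have hcomp : EqOn (fun r : ℝ => |2 * r / (1 + r ^ 2) ^ 2| •
      (((r ^ 2 / (1 + r ^ 2) : ℝ) : ℂ) ^ (u - 1) *
      (1 - ((r ^ 2 / (1 + r ^ 2) : ℝ) : ℂ)) ^ (v - 1)))
      (fun r : ℝ => 2 * ((r : ℂ) ^ (2 * u - 1) * ((1 + r ^ 2 : ℝ) : ℂ) ^ (-(u + v)))) (Ioi 0) :=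
    fun r hr => beta_integrand_comp hr u v
  constructor
  · have h1 := Complex.betaIntegral_convergent hu hv
    rw [intervalIntegrable_iff_integrableOn_Ioo_of_le zero_le_one, ← image_sq_div_one_add_sq,
      integrableOn_image_iff_integrableOn_abs_deriv_smul measurableSet_Ioi hder
      injOn_sq_div_one_add_sq, integrableOn_congr_fun hcomp measurableSet_Ioi] at h1
    have h2 := h1.const_mul (1 / 2)
    simpa [IntegrableOn] using h2
  · have h1 := Complex.betaIntegral_eq_Gamma_mul_div u v hu hv
    rw [Complex.betaIntegral, intervalIntegral.integral_of_le zero_le_one,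
      integral_Ioc_eq_integral_Ioo, ← image_sq_div_one_add_sq,
      integral_image_eq_integral_abs_deriv_smul measurableSet_Ioi hder
      injOn_sq_div_one_add_sq, setIntegral_congr_fun measurableSet_Ioi hcomp,
      integral_const_mul] at h1
    rw [mul_comm 2 (Complex.Gamma (u + v)), ← div_div, ← h1]
    ring

end BetaIntegral

section Radial

variable {κ : Type} [Fintype κ]

/-- Puts the polar integrand into the form of `beta_halfLine` with `u = (b + d) / 2` and `v = s -
u`, where `d` is the dimension. -/
lemma radial_integrand_eq [Nonempty κ] (b s : ℂ) {r : ℝ} (hr : 0 < r) :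
    r ^ (Module.finrank ℝ (EuclideanSpace ℝ κ) - 1) •
      ((r : ℂ) ^ b * ((1 + r ^ 2 : ℝ) : ℂ) ^ (-s))
    = (r : ℂ) ^ (2 * ((b + Fintype.card κ) / 2) - 1) * ((1 + r ^ 2 : ℝ) : ℂ) ^
      (-((b + Fintype.card κ) / 2 + (s - (b + Fintype.card κ) / 2))) := by
  have hrc : (r : ℂ) ≠ 0 := by exact_mod_cast hr.ne'
  rw [finrank_euclideanSpace, Complex.real_smul, Complex.ofReal_pow, ← Complex.cpow_natCast,
    ← mul_assoc, ← Complex.cpow_add _ _ hrc, Nat.cast_sub Fintype.card_pos]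
  congr 2 <;> push_cast <;> ring

/-- The integral of `|x|^b (1 + |x|²)^{-s}`. -/
lemma integral_radial [Nonempty κ] {b s : ℂ} (hb : 0 < (b + Fintype.card κ).re)
    (hs : (b + Fintype.card κ).re < 2 * s.re) :
    Integrable (fun x : EuclideanSpace ℝ κ =>
      ((‖x‖ : ℝ) : ℂ) ^ b * ((1 + ‖x‖ ^ 2 : ℝ) : ℂ) ^ (-s)) ∧
    ∫ x : EuclideanSpace ℝ κ, ((‖x‖ : ℝ) : ℂ) ^ b * ((1 + ‖x‖ ^ 2 : ℝ) : ℂ) ^ (-s)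
      = (Real.pi : ℂ) ^ ((Fintype.card κ : ℂ) / 2) / Complex.Gamma ((Fintype.card κ : ℂ) / 2) *
        (Complex.Gamma ((b + Fintype.card κ) / 2) *
          Complex.Gamma (s - (b + Fintype.card κ) / 2) / Complex.Gamma s) := by
  have hu : 0 < ((b + Fintype.card κ) / 2).re := by
    rw [Complex.div_ofNat_re]; linarith
  have hv : 0 < (s - (b + Fintype.card κ) / 2).re := by
    rw [Complex.sub_re, Complex.div_ofNat_re]; linarith
  have h := beta_halfLine hu hv
  have hcongr : EqOn (fun r : ℝ => r ^ (Module.finrank ℝ (EuclideanSpace ℝ κ) - 1) •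
      ((r : ℂ) ^ b * ((1 + r ^ 2 : ℝ) : ℂ) ^ (-s))) _ (Ioi 0) :=
    fun r hr => radial_integrand_eq b s hr
  constructor
  · refine (integrable_fun_norm_addHaar (E := EuclideanSpace ℝ κ) volume
      (f := fun r : ℝ => (r : ℂ) ^ b * ((1 + r ^ 2 : ℝ) : ℂ) ^ (-s))).2 ?_
    rw [integrableOn_congr_fun hcongr measurableSet_Ioi]
    exact h.1
  · rw [integral_fun_norm_addHaar (E := EuclideanSpace ℝ κ) volume
      (fun r : ℝ => (r : ℂ) ^ b * ((1 + r ^ 2 : ℝ) : ℂ) ^ (-s)),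
      setIntegral_congr_fun measurableSet_Ioi hcongr, h.2, finrank_euclideanSpace,
      measureReal_def, EuclideanSpace.volume_ball]
    have hcard : (0 : ℝ) < Fintype.card κ := by exact_mod_cast Fintype.card_pos
    have hG : 0 < Real.Gamma ((Fintype.card κ : ℝ) / 2) := Real.Gamma_pos_of_pos (by positivity)
    have hGc : Complex.Gamma ((Fintype.card κ : ℂ) / 2)
        = ((Real.Gamma ((Fintype.card κ : ℝ) / 2) : ℝ) : ℂ) := by
      rw [← Complex.Gamma_ofReal]; push_cast; rfl
    have hpi : (Real.pi : ℂ) ^ ((Fintype.card κ : ℂ) / 2)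
        = ((√Real.pi ^ Fintype.card κ : ℝ) : ℂ) := by
      rw [Real.sqrt_eq_rpow, ← Real.rpow_natCast, ← Real.rpow_mul Real.pi_pos.le,
        Complex.ofReal_cpow Real.pi_pos.le]
      congr 1; push_cast; ring
    rw [ENNReal.ofReal_one, one_pow, one_mul, Real.Gamma_add_one (by positivity),
      ENNReal.toReal_ofReal (by positivity), hGc, hpi, nsmul_eq_mul, Complex.real_smul,
      show (b + Fintype.card κ) / 2 + (s - (b + Fintype.card κ) / 2) = s by ring]
    have hcc : (Fintype.card κ : ℂ) ≠ 0 := by exact_mod_cast hcard.ne'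
    have hGcc : ((Real.Gamma ((Fintype.card κ : ℝ) / 2) : ℝ) : ℂ) ≠ 0 := by exact_mod_cast hG.ne'
    push_cast at hGcc ⊢
    -- If `Γ(s)` is 0 in Lean, both sides are quotients by 0; otherwise it can be cleared.
    by_cases h0 : Complex.Gamma s = 0
    · simp [h0]
    · field_simp

variable (κ) in
/-- The value of the integral of `(1 + |x|²)^{-s}`. -/
noncomputable def japaneseValue (s : ℂ) : ℂ :=
  (Real.pi : ℂ) ^ ((Fintype.card κ : ℂ) / 2) * Complex.Gamma (s - Fintype.card κ / 2)
    / Complex.Gamma s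

/-- The integral of `(1 + |x|²)^{-s}`, in any dimension. -/
lemma integral_japanese {s : ℂ} (hs : (Fintype.card κ : ℝ) < 2 * s.re) :
    Integrable (fun x : EuclideanSpace ℝ κ => ((1 + ‖x‖ ^ 2 : ℝ) : ℂ) ^ (-s)) ∧
    ∫ x : EuclideanSpace ℝ κ, ((1 + ‖x‖ ^ 2 : ℝ) : ℂ) ^ (-s) = japaneseValue κ s := by
  rcases isEmpty_or_nonempty κ with hκ | hκ
  -- In dimension 0 the measure is a point mass, and the two Gamma factors must cancel, so `Γ(s) ≠
  -- 0` is needed.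
  · have hG : Complex.Gamma s ≠ 0 := Complex.Gamma_ne_zero_of_re_pos (by
      have : (0 : ℝ) ≤ Fintype.card κ := Nat.cast_nonneg _
      linarith)
    rw [volume_euclideanSpace_eq_dirac]
    refine ⟨integrable_dirac (by simp), ?_⟩
    rw [integral_dirac]
    simp [japaneseValue, Fintype.card_eq_zero, div_self hG]
  · have hd : (0 : ℝ) < Fintype.card κ := by exact_mod_cast Fintype.card_pos
    have h := integral_radial (κ := κ) (b := 0) (s := s) (by simpa using Fintype.card_pos)
      (by simpa using hs)
    have hG : Complex.Gamma ((Fintype.card κ : ℂ) / 2) ≠ 0 :=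
      Complex.Gamma_ne_zero_of_re_pos (by
        rw [Complex.div_ofNat_re, Complex.natCast_re]; positivity)
    simp only [Complex.cpow_zero, one_mul, zero_add] at h
    refine ⟨h.1, h.2.trans ?_⟩
    rw [japaneseValue]
    field_simp

lemma add_norm_sq_cpow {A : ℝ} (hA : 0 < A) (s : ℂ) (x : EuclideanSpace ℝ κ) :
    ((A + ‖x‖ ^ 2 : ℝ) : ℂ) ^ (-s)
      = (A : ℂ) ^ (-s) * ((1 + ‖(√A)⁻¹ • x‖ ^ 2 : ℝ) : ℂ) ^ (-s) := by
  rw [← Complex.mul_cpow_ofReal_nonneg hA.le (by positivity), ← Complex.ofReal_mul, norm_smul,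
    norm_inv, Real.norm_of_nonneg (Real.sqrt_nonneg A), mul_pow, inv_pow, Real.sq_sqrt hA.le]
  congr 2
  field_simp

lemma sqrt_pow_card {A : ℝ} (hA : 0 < A) (s : ℂ) (d : ℕ) :
    (A : ℂ) ^ (-s) * ((√A ^ d : ℝ) : ℂ) = (A : ℂ) ^ (-(s - d / 2)) := by
  have hAc : (A : ℂ) ≠ 0 := by exact_mod_cast hA.ne'
  rw [Real.sqrt_eq_rpow, ← Real.rpow_natCast, ← Real.rpow_mul hA.le, Complex.ofReal_cpow hA.le,
    ← Complex.cpow_add _ _ hAc]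
  congr 1; push_cast; ring

lemma abs_inv_sqrt_pow (A : ℝ) (d : ℕ) : |(((√A)⁻¹) ^ d)⁻¹| = √A ^ d := by
  rw [inv_pow, inv_inv, abs_of_nonneg (by positivity)]

/-- The integral of `(A + |x|²)^{-s}`. -/
lemma integral_japanese_scaled {s : ℂ} (hs : (Fintype.card κ : ℝ) < 2 * s.re) {A : ℝ} (hA : 0 < A) :
    Integrable (fun x : EuclideanSpace ℝ κ => ((A + ‖x‖ ^ 2 : ℝ) : ℂ) ^ (-s)) ∧
    ∫ x : EuclideanSpace ℝ κ, ((A + ‖x‖ ^ 2 : ℝ) : ℂ) ^ (-s)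
      = (A : ℂ) ^ (-(s - Fintype.card κ / 2)) * japaneseValue κ s ∧
    ∫ x : EuclideanSpace ℝ κ, ‖((A + ‖x‖ ^ 2 : ℝ) : ℂ) ^ (-s)‖
      = ‖(A : ℂ) ^ (-(s - Fintype.card κ / 2))‖ *
        ∫ x : EuclideanSpace ℝ κ, ‖((1 + ‖x‖ ^ 2 : ℝ) : ℂ) ^ (-s)‖ := by
  have h := integral_japanese hs
  have hne : (√A)⁻¹ ≠ 0 := inv_ne_zero (Real.sqrt_pos.2 hA).ne'
  simp only [add_norm_sq_cpow hA]
  refine ⟨(h.1.comp_smul hne).const_mul _, ?_, ?_⟩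
  · rw [integral_const_mul, Measure.integral_comp_smul volume
      (fun x : EuclideanSpace ℝ κ => ((1 + ‖x‖ ^ 2 : ℝ) : ℂ) ^ (-s)), h.2, finrank_euclideanSpace,
      abs_inv_sqrt_pow, Complex.real_smul, ← mul_assoc, sqrt_pow_card hA]
  · simp only [norm_mul]
    rw [integral_const_mul, Measure.integral_comp_smul volume
      (fun x : EuclideanSpace ℝ κ => ‖((1 + ‖x‖ ^ 2 : ℝ) : ℂ) ^ (-s)‖), finrank_euclideanSpace,
      abs_inv_sqrt_pow, smul_eq_mul, ← mul_assoc, ← sqrt_pow_card hA, norm_mul,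
      Complex.norm_of_nonneg (by positivity)]

end Radial

section Split

variable {ι κ : Type} [Fintype ι] [Fintype κ]

lemma measurePreserving_parts :
    MeasurePreserving (fun x : EuclideanSpace ℝ (ι ⊕ κ) => (fstPart x, sndPart x)) :=
  (((PiLp.volume_preserving_toLp ι).prod (PiLp.volume_preserving_toLp κ)).comp
    (volume_measurePreserving_sumPiEquivProdPi (fun _ : ι ⊕ κ => ℝ))).comp
    (PiLp.volume_preserving_ofLp (ι ⊕ κ))

lemma norm_sq_eq_parts (x : EuclideanSpace ℝ (ι ⊕ κ)) :
    ‖x‖ ^ 2 = ‖fstPart x‖ ^ 2 + ‖sndPart x‖ ^ 2 := by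
  simp only [EuclideanSpace.norm_sq_eq, Fintype.sum_sum_type, fstPart, sndPart]

/-- The integral of `|x''|^b (1 + |x|²)^{-s}`. -/
lemma integral_weighted_japanese [Nonempty κ] {b s : ℂ} (hb : 0 < (b + Fintype.card κ).re)
    (hs : (b + Fintype.card κ).re < 2 * s.re - Fintype.card ι) :
    Integrable (fun x : EuclideanSpace ℝ (ι ⊕ κ) =>
      ((‖sndPart x‖ : ℝ) : ℂ) ^ b * ((1 + ‖x‖ ^ 2 : ℝ) : ℂ) ^ (-s)) ∧
    ∫ x : EuclideanSpace ℝ (ι ⊕ κ), ((‖sndPart x‖ : ℝ) : ℂ) ^ b * ((1 + ‖x‖ ^ 2 : ℝ) : ℂ) ^ (-s)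
      = (Real.pi : ℂ) ^ ((Fintype.card ι : ℂ) / 2) * (Real.pi : ℂ) ^ ((Fintype.card κ : ℂ) / 2) /
        Complex.Gamma ((Fintype.card κ : ℂ) / 2) *
        (Complex.Gamma ((b + Fintype.card κ) / 2) *
          Complex.Gamma (s - Fintype.card ι / 2 - (b + Fintype.card κ) / 2) / Complex.Gamma s) := by
  have hs1 : (Fintype.card ι : ℝ) < 2 * s.re := by linarith
  have hsre : (s - Fintype.card ι / 2).re = s.re - Fintype.card ι / 2 := by simp
  have hrad := integral_radial (κ := κ) (b := b) (s := s - Fintype.card ι / 2) hb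
    (by rw [hsre]; linarith)
  set F : EuclideanSpace ℝ ι × EuclideanSpace ℝ κ → ℂ := fun q =>
    ((‖q.2‖ : ℝ) : ℂ) ^ b * (((1 + ‖q.2‖ ^ 2) + ‖q.1‖ ^ 2 : ℝ) : ℂ) ^ (-s) with hF
  have hFm : AEStronglyMeasurable F (volume.prod volume) := by
    refine Measurable.aestronglyMeasurable ?_
    rw [hF]
    fun_prop
  have hpos : ∀ w : EuclideanSpace ℝ κ, 0 < 1 + ‖w‖ ^ 2 := fun w => by positivity
  -- Tonelli: integrating `‖F‖` over `x'` by scaling with `A = 1 + ‖x''‖²` leaves the radial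
  -- integrand with `s` lowered by `card ι / 2`.
  have hFi : Integrable F (volume.prod volume) := by
    rw [integrable_prod_iff' hFm]
    constructor
    · exact Filter.Eventually.of_forall fun w =>
        (integral_japanese_scaled hs1 (hpos w)).1.const_mul (((‖w‖ : ℝ) : ℂ) ^ b)
    · have : (fun w : EuclideanSpace ℝ κ => ∫ u : EuclideanSpace ℝ ι, ‖F (u, w)‖) = fun w =>
          ‖((‖w‖ : ℝ) : ℂ) ^ b * ((1 + ‖w‖ ^ 2 : ℝ) : ℂ) ^ (-(s - Fintype.card ι / 2))‖ *
            ∫ x : EuclideanSpace ℝ ι, ‖((1 + ‖x‖ ^ 2 : ℝ) : ℂ) ^ (-s)‖ := by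
        funext w
        simp only [hF, norm_mul]
        rw [integral_const_mul, (integral_japanese_scaled hs1 (hpos w)).2.2, mul_assoc]
      rw [this]
      exact hrad.1.norm.mul_const _
  have hmp := measurePreserving_parts (ι := ι) (κ := κ)
  have hcomp : (fun x : EuclideanSpace ℝ (ι ⊕ κ) =>
      ((‖sndPart x‖ : ℝ) : ℂ) ^ b * ((1 + ‖x‖ ^ 2 : ℝ) : ℂ) ^ (-s))
      = fun x => F (fstPart x, sndPart x) := by
    funext x
    simp only [hF, norm_sq_eq_parts x]
    congr 3
    ring
  rw [hcomp]
  refine ⟨hmp.integrable_comp_of_integrable hFi, ?_⟩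
  have hint := integral_map hmp.measurable.aemeasurable (by rw [hmp.map_eq]; exact hFm)
  rw [← hint, hmp.map_eq]
  rw [Measure.volume_eq_prod, integral_prod_symm F hFi]
  have hG : Complex.Gamma (s - Fintype.card ι / 2) ≠ 0 :=
    Complex.Gamma_ne_zero_of_re_pos (by rw [hsre]; linarith)
  calc ∫ w, ∫ u, F (u, w) = ∫ w : EuclideanSpace ℝ κ, ((‖w‖ : ℝ) : ℂ) ^ b *
        ((1 + ‖w‖ ^ 2 : ℝ) : ℂ) ^ (-(s - Fintype.card ι / 2)) * japaneseValue ι s := by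
        congr 1
        funext w
        simp only [hF]
        rw [integral_const_mul, (integral_japanese_scaled hs1 (hpos w)).2.1, mul_assoc]
    _ = _ := by
        rw [integral_mul_const, hrad.2, japaneseValue]
        -- This factor is in the denominator of the radial integral and in the numerator of
        -- `japaneseValue`, and cancels.
        generalize Complex.Gamma (s - Fintype.card ι / 2) = g at hG
        field_simp

end Split

end ModelForm

/-! ### Inversions and the kernel of the model form. -/

namespace ModelForm

open MeasureTheory Set

section Inversion

open EuclideanGeometry

variable {ι κ : Type} [Fintype ι] [Fintype κ]

/-- The point `(y, 0)`. -/
noncomputable def leftEmb (y : EuclideanSpace ℝ ι) : EuclideanSpace ℝ (ι ⊕ κ) :=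
  WithLp.toLp 2 (Sum.elim (fun i => y i) (fun _ => 0))

lemma norm_leftEmb_sq (y : EuclideanSpace ℝ ι) :
    ‖(leftEmb y : EuclideanSpace ℝ (ι ⊕ κ))‖ ^ 2 = ‖y‖ ^ 2 := by
  simp [EuclideanSpace.norm_sq_eq, leftEmb]

lemma norm_sub_leftEmb_sq (x : EuclideanSpace ℝ (ι ⊕ κ)) (y : EuclideanSpace ℝ ι) :
    ‖x - leftEmb y‖ ^ 2 = ‖fstPart x - y‖ ^ 2 + ‖sndPart x‖ ^ 2 := by
  simp [EuclideanSpace.norm_sq_eq, leftEmb, fstPart, sndPart]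

lemma sndPart_inversion (x : EuclideanSpace ℝ (ι ⊕ κ)) (y : EuclideanSpace ℝ ι) (R : ℝ) :
    ‖sndPart (inversion (leftEmb y) R x)‖ = (R / dist x (leftEmb y)) ^ 2 * ‖sndPart x‖ := by
  have : sndPart (inversion (leftEmb y) R x) = (R / dist x (leftEmb y)) ^ 2 • sndPart x := by
    ext j
    simp [sndPart, inversion, leftEmb]
  rw [this, norm_smul, Real.norm_of_nonneg (sq_nonneg _)]

/-- Inversion in a sphere through the base point of the upper half space. -/
lemma one_add_norm_inversion_sq {E : Type*} [NormedAddCommGroup E] [InnerProductSpace ℝ E]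
    {c x : E} (hx : x ≠ c) {R : ℝ} (hR : R ^ 2 = 1 + ‖c‖ ^ 2) :
    1 + ‖inversion c R x‖ ^ 2 = (R / dist x c) ^ 2 * (1 + ‖x‖ ^ 2) := by
  have hD : ‖x - c‖ ≠ 0 := norm_ne_zero_iff.2 (sub_ne_zero.2 hx)
  obtain ⟨v, rfl⟩ : ∃ v, x = v + c := ⟨x - c, by simp⟩
  rw [add_sub_cancel_right] at hD
  rw [inversion, dist_eq_norm, vsub_eq_sub, vadd_eq_add, add_sub_cancel_right, norm_add_sq_real,
    norm_add_sq_real, norm_smul, inner_smul_left, Real.norm_of_nonneg (sq_nonneg _), div_pow, hR]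
  simp only [conj_trivial]
  field_simp
  ring

/-- The derivative of an inversion at `x` is `(R / dist x c)²` times a reflection; this computes its
Jacobian. -/
lemma abs_det_smul_reflection {E : Type*} [NormedAddCommGroup E] [InnerProductSpace ℝ E]
    [FiniteDimensional ℝ E] {t : ℝ} (ht : 0 ≤ t) (K : Submodule ℝ E) :
    |(t • (K.reflection : E →L[ℝ] E)).det| = t ^ Module.finrank ℝ E := by
  have h : |LinearMap.det ((K.reflection.toLinearEquiv : E ≃ₗ[ℝ] E) : E →ₗ[ℝ] E)| = 1 := by
    erw [Submodule.det_reflection]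
    simp
  rw [ContinuousLinearMap.det, ContinuousLinearMap.toLinearMap_smul, LinearMap.det_smul, abs_mul,
    abs_of_nonneg (pow_nonneg ht _)]
  exact (congrArg _ h).trans (mul_one _)

lemma image_inversion_compl {E : Type*} [NormedAddCommGroup E] [InnerProductSpace ℝ E]
    (c : E) {R : ℝ} (hR : R ≠ 0) : inversion c R '' {c}ᶜ = {c}ᶜ := by
  rw [image_compl_eq (inversion_bijective c hR), image_singleton, inversion_self]

variable {F : Type*} [NormedAddCommGroup F] [NormedSpace ℝ F]

/-- Change of variables by an inversion. -/
lemma integrable_inversion_iff {E : Type*} [NormedAddCommGroup E] [InnerProductSpace ℝ E]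
    [FiniteDimensional ℝ E] [MeasurableSpace E] [BorelSpace E] [Nontrivial E]
    (c : E) {R : ℝ} (hR : R ≠ 0) (g : E → F) :
    Integrable g ↔ Integrable (fun x =>
      ((R / dist x c) ^ 2) ^ Module.finrank ℝ E • g (inversion c R x)) := by
  have h := integrableOn_image_iff_integrableOn_abs_det_fderiv_smul (volume : Measure E)
    (MeasurableSet.singleton c).compl
    (fun x hx => (hasFDerivAt_inversion (R := R) (c := c) (x := x) hx).hasFDerivWithinAt)
    (inversion_injective c hR).injOn g
  simpa only [image_inversion_compl c hR, IntegrableOn, restrict_compl_singleton,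
    abs_det_smul_reflection (sq_nonneg _)] using h

lemma integral_inversion {E : Type*} [NormedAddCommGroup E] [InnerProductSpace ℝ E]
    [FiniteDimensional ℝ E] [MeasurableSpace E] [BorelSpace E] [Nontrivial E]
    (c : E) {R : ℝ} (hR : R ≠ 0) (g : E → F) :
    ∫ x, g x = ∫ x, ((R / dist x c) ^ 2) ^ Module.finrank ℝ E • g (inversion c R x) := by
  have h := integral_image_eq_integral_abs_det_fderiv_smul (volume : Measure E)
    (MeasurableSet.singleton c).compl
    (fun x hx => (hasFDerivAt_inversion (R := R) (c := c) (x := x) hx).hasFDerivWithinAt)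
    (inversion_injective c hR).injOn g
  simpa only [image_inversion_compl c hR, restrict_compl_singleton,
    abs_det_smul_reflection (sq_nonneg _)] using h

/-- The kernel of the model form against the spherical vector in the first variable. -/
noncomputable def sphericalKernel (a b s : ℂ) (y : EuclideanSpace ℝ ι)
    (x : EuclideanSpace ℝ (ι ⊕ κ)) : ℂ :=
  ((‖fstPart x - y‖ ^ 2 + ‖sndPart x‖ ^ 2 : ℝ) : ℂ) ^ a * ((‖sndPart x‖ : ℝ) : ℂ) ^ b
    * ((1 + ‖x‖ ^ 2 : ℝ) : ℂ) ^ (-s)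

/-- The hypothesis on `a`, `b`, `s` is the homogeneity that makes the conformal factors of the
kernel and of the Jacobian cancel. -/
lemma sphericalKernel_inversion {a b s : ℂ} (h : a + b + Fintype.card (ι ⊕ κ) = s)
    {x : EuclideanSpace ℝ (ι ⊕ κ)} {y : EuclideanSpace ℝ ι} (hx : x ≠ leftEmb y) :
    ((√(1 + ‖y‖ ^ 2) / dist x (leftEmb y)) ^ 2) ^
        Module.finrank ℝ (EuclideanSpace ℝ (ι ⊕ κ)) •
      sphericalKernel a b s y (inversion (leftEmb y) (√(1 + ‖y‖ ^ 2)) x)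
    = ((1 + ‖y‖ ^ 2 : ℝ) : ℂ) ^ a *
      (((‖sndPart x‖ : ℝ) : ℂ) ^ b * ((1 + ‖x‖ ^ 2 : ℝ) : ℂ) ^ (-s)) := by
  set c : EuclideanSpace ℝ (ι ⊕ κ) := leftEmb y with hc
  have hA : 0 < 1 + ‖y‖ ^ 2 := by positivity
  have hR : √(1 + ‖y‖ ^ 2) ^ 2 = 1 + ‖c‖ ^ 2 := by
    rw [Real.sq_sqrt hA.le, hc, norm_leftEmb_sq]
  have hD : 0 < dist x c := dist_pos.2 hx
  set t : ℝ := (√(1 + ‖y‖ ^ 2) / dist x c) ^ 2 with ht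
  have htpos : 0 < t := by have := Real.sqrt_pos.2 hA; positivity
  have htc : (t : ℂ) ≠ 0 := by exact_mod_cast htpos.ne'
  have h1 : ‖fstPart (inversion c (√(1 + ‖y‖ ^ 2)) x) - y‖ ^ 2
      + ‖sndPart (inversion c (√(1 + ‖y‖ ^ 2)) x)‖ ^ 2 = (1 + ‖y‖ ^ 2) * t := by
    rw [← norm_sub_leftEmb_sq, ← dist_eq_norm, ← hc, dist_inversion_center, ht, div_pow, div_pow,
      Real.sq_sqrt hA.le]
    ring
  rw [sphericalKernel, h1, sndPart_inversion, ← hc, ← ht, one_add_norm_inversion_sq hx hR, ← ht,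
    Complex.real_smul, Complex.ofReal_mul, Complex.ofReal_mul, Complex.ofReal_mul,
    Complex.mul_cpow_ofReal_nonneg hA.le htpos.le, Complex.mul_cpow_ofReal_nonneg htpos.le
    (norm_nonneg _), Complex.mul_cpow_ofReal_nonneg htpos.le (by positivity), Complex.ofReal_pow,
    ← Complex.cpow_natCast, finrank_euclideanSpace]
  have key : (t : ℂ) ^ ((Fintype.card (ι ⊕ κ) : ℕ) : ℂ) * (t : ℂ) ^ a * (t : ℂ) ^ b
      * (t : ℂ) ^ (-s) = 1 := by
    rw [← Complex.cpow_add _ _ htc, ← Complex.cpow_add _ _ htc, ← Complex.cpow_add _ _ htc,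
      ← Complex.cpow_zero (t : ℂ)]
    congr 1
    rw [← h]; ring
  linear_combination (((1 + ‖y‖ ^ 2 : ℝ) : ℂ) ^ a *
      (((‖sndPart x‖ : ℝ) : ℂ) ^ b * ((1 + ‖x‖ ^ 2 : ℝ) : ℂ) ^ (-s))) * key

variable [Nonempty κ]

lemma sphericalKernel_inversion_ae {a b s : ℂ} (h : a + b + Fintype.card (ι ⊕ κ) = s)
    (y : EuclideanSpace ℝ ι) :
    (fun x : EuclideanSpace ℝ (ι ⊕ κ) => ((√(1 + ‖y‖ ^ 2) / dist x (leftEmb y)) ^ 2) ^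
        Module.finrank ℝ (EuclideanSpace ℝ (ι ⊕ κ)) •
      sphericalKernel a b s y (inversion (leftEmb y) (√(1 + ‖y‖ ^ 2)) x))
    =ᵐ[volume] fun x => ((1 + ‖y‖ ^ 2 : ℝ) : ℂ) ^ a *
      (((‖sndPart x‖ : ℝ) : ℂ) ^ b * ((1 + ‖x‖ ^ 2 : ℝ) : ℂ) ^ (-s)) := by
  filter_upwards [compl_mem_ae_iff.2 (measure_singleton (leftEmb y))] with x hx
  exact sphericalKernel_inversion h hx

/-- The integral of the kernel over the first variable, up to the integral of
`|x''|^b (1 + |x|²)^{-s}`. -/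
lemma integral_sphericalKernel {a b s : ℂ} (h : a + b + Fintype.card (ι ⊕ κ) = s)
    (hg : Integrable (fun x : EuclideanSpace ℝ (ι ⊕ κ) =>
      ((‖sndPart x‖ : ℝ) : ℂ) ^ b * ((1 + ‖x‖ ^ 2 : ℝ) : ℂ) ^ (-s)))
    (y : EuclideanSpace ℝ ι) :
    Integrable (sphericalKernel (κ := κ) a b s y) ∧
    ∫ x : EuclideanSpace ℝ (ι ⊕ κ), sphericalKernel a b s y x
      = ((1 + ‖y‖ ^ 2 : ℝ) : ℂ) ^ a * ∫ x : EuclideanSpace ℝ (ι ⊕ κ),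
        ((‖sndPart x‖ : ℝ) : ℂ) ^ b * ((1 + ‖x‖ ^ 2 : ℝ) : ℂ) ^ (-s) ∧
    ∫ x : EuclideanSpace ℝ (ι ⊕ κ), ‖sphericalKernel a b s y x‖
      = ‖((1 + ‖y‖ ^ 2 : ℝ) : ℂ) ^ a‖ * ∫ x : EuclideanSpace ℝ (ι ⊕ κ),
        ‖((‖sndPart x‖ : ℝ) : ℂ) ^ b * ((1 + ‖x‖ ^ 2 : ℝ) : ℂ) ^ (-s)‖ := by
  have hR : √(1 + ‖y‖ ^ 2) ≠ 0 := (Real.sqrt_pos.2 (by positivity)).ne'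
  have hae := sphericalKernel_inversion_ae (κ := κ) h y
  refine ⟨?_, ?_, ?_⟩
  · rw [integrable_inversion_iff (leftEmb y) hR, integrable_congr hae]
    exact hg.const_mul _
  · rw [integral_inversion (leftEmb y) hR, integral_congr_ae hae, integral_const_mul]
  · rw [integral_inversion (leftEmb y) hR, ← integral_const_mul]
    refine integral_congr_ae ?_
    filter_upwards [hae] with x hx
    rw [← norm_mul, ← hx, norm_smul, Real.norm_of_nonneg (by positivity), smul_eq_mul]

end Inversion

end ModelForm

/-! ### The model integral in the region of convergence. -/

namespace ModelForm

open MeasureTheory Set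

section Convergence

variable {ι κ : Type} [Fintype ι] [Fintype κ]

lemma rho_card_add_one (k : ℕ) : rho (k + 1) = (k : ℝ) / 2 := by
  rw [rho]; push_cast; ring

variable (ι) in
/-- The integral of `(1 + |y|²)^{-2ρ'}`, in any dimension. -/
lemma integral_japanese_self :
    Integrable (fun y : EuclideanSpace ℝ ι => ((1 + ‖y‖ ^ 2 : ℝ) : ℂ) ^ (-(Fintype.card ι : ℂ))) ∧
    ∫ y : EuclideanSpace ℝ ι, ((1 + ‖y‖ ^ 2 : ℝ) : ℂ) ^ (-(Fintype.card ι : ℂ))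
      = (Real.pi : ℂ) ^ ((Fintype.card ι : ℂ) / 2) * gammaQuotient (Fintype.card ι + 1) := by
  rcases isEmpty_or_nonempty ι with hι | hι
  -- Here the exponent is 0, outside the range of `integral_japanese`; Lean would read `Γ(0) / Γ(0)`
  -- as 0, which is why `gammaQuotient` is set to 1.
  · rw [volume_euclideanSpace_eq_dirac]
    refine ⟨integrable_dirac (by simp), ?_⟩
    rw [integral_dirac]
    simp [gammaQuotient, Fintype.card_eq_zero]
  · have hd : 0 < Fintype.card ι := Fintype.card_pos
    have hd' : (0 : ℝ) < Fintype.card ι := by exact_mod_cast hd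
    have h := integral_japanese (κ := ι) (s := Fintype.card ι)
      (by rw [Complex.natCast_re]; linarith)
    refine ⟨h.1, h.2.trans ?_⟩
    rw [japaneseValue, gammaQuotient, if_neg (by omega), rho_card_add_one, mul_div_assoc]
    congr 3
    · push_cast; ring_nf
    · push_cast; ring_nf

lemma measurable_fstPart : Measurable (fstPart : EuclideanSpace ℝ (ι ⊕ κ) → EuclideanSpace ℝ ι) :=
  measurePreserving_parts.measurable.fst

lemma measurable_sndPart : Measurable (sndPart : EuclideanSpace ℝ (ι ⊕ κ) → EuclideanSpace ℝ κ) :=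
  measurePreserving_parts.measurable.snd

lemma measurable_modelIntegrand_spherical (ν ν' : ℂ) :
    Measurable (fun p : EuclideanSpace ℝ (ι ⊕ κ) × EuclideanSpace ℝ ι =>
      modelIntegrand ν ν' (spherical (ι ⊕ κ) ν) (spherical ι ν') p.1 p.2) := by
  have h1 := measurable_fstPart (ι := ι) (κ := κ)
  have h2 := measurable_sndPart (ι := ι) (κ := κ)
  unfold modelIntegrand spherical
  fun_prop

/-- The model integral of the spherical vectors in the region of convergence. -/
theorem modelIntegral_spherical [Nonempty κ] {ν ν' : ℂ} (h : (ν, ν') ∈ convRegion ι κ) :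
    Integrable (fun p : EuclideanSpace ℝ (ι ⊕ κ) × EuclideanSpace ℝ ι =>
      modelIntegrand ν ν' (spherical (ι ⊕ κ) ν) (spherical ι ν') p.1 p.2) ∧
    modelIntegral ν ν' (spherical (ι ⊕ κ) ν) (spherical ι ν')
      = specialValue (Fintype.card (ι ⊕ κ) + 1) (Fintype.card ι + 1) ν ν' := by
  obtain ⟨h1, h2⟩ := h
  simp only [rho_card_add_one, Fintype.card_sum, Nat.cast_add] at h1 h2
  have hκ : (0 : ℝ) < Fintype.card κ := by exact_mod_cast Fintype.card_pos
  have hι : (0 : ℝ) ≤ Fintype.card ι := Nat.cast_nonneg _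
  set a : ℂ := ν' - rho (Fintype.card ι + 1) with ha
  set b : ℂ := (ν - rho (Fintype.card (ι ⊕ κ) + 1)) - (ν' - rho (Fintype.card ι + 1)) with hb
  set s : ℂ := ν + rho (Fintype.card (ι ⊕ κ) + 1) with hs
  have ha' : a = ν' - Fintype.card ι / 2 := by
    rw [ha, rho_card_add_one]; push_cast; ring
  have hb' : b = ν - (Fintype.card ι + Fintype.card κ) / 2 - (ν' - Fintype.card ι / 2) := by
    rw [hb, rho_card_add_one, rho_card_add_one, Fintype.card_sum]; push_cast; ring
  have hs' : s = ν + (Fintype.card ι + Fintype.card κ) / 2 := by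
    rw [hs, rho_card_add_one, Fintype.card_sum]; push_cast; ring
  have hbre : b.re =
      ν.re - (Fintype.card ι + Fintype.card κ) / 2 - (ν'.re - Fintype.card ι / 2) := by
    rw [hb']; simp
  have hsre : s.re = ν.re + (Fintype.card ι + Fintype.card κ) / 2 := by
    rw [hs']; simp
  have hrel : a + b + Fintype.card (ι ⊕ κ) = s := by
    rw [ha', hb', hs', Fintype.card_sum]; push_cast; ring
  have hmi : ∀ (x : EuclideanSpace ℝ (ι ⊕ κ)) (y : EuclideanSpace ℝ ι),
      modelIntegrand ν ν' (spherical (ι ⊕ κ) ν) (spherical ι ν') x y = sphericalKernel a b s y x *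
        ((1 + ‖y‖ ^ 2 : ℝ) : ℂ) ^ (-(ν' + rho (Fintype.card ι + 1))) :=
    fun _ _ => rfl
  have hG := integral_weighted_japanese (ι := ι) (κ := κ) (b := b) (s := s)
    (by rw [Complex.add_re, Complex.natCast_re, hbre]; linarith)
    (by rw [Complex.add_re, Complex.natCast_re, hbre, hsre]; linarith)
  have hK := fun y : EuclideanSpace ℝ ι => integral_sphericalKernel hrel hG.1 y
  -- The exponent is `(ν' - ρ') - (ν' + ρ') = -2ρ'`, so the parameters drop out of the `y`-integral.
  have hexp : ∀ y : EuclideanSpace ℝ ι, ((1 + ‖y‖ ^ 2 : ℝ) : ℂ) ^ a *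
      ((1 + ‖y‖ ^ 2 : ℝ) : ℂ) ^ (-(ν' + rho (Fintype.card ι + 1)))
      = ((1 + ‖y‖ ^ 2 : ℝ) : ℂ) ^ (-(Fintype.card ι : ℂ)) := by
    intro y
    have hne : ((1 + ‖y‖ ^ 2 : ℝ) : ℂ) ≠ 0 := by
      rw [Complex.ofReal_ne_zero]; positivity
    rw [← Complex.cpow_add _ _ hne, ha', rho_card_add_one]
    congr 1
    push_cast; ring
  have hint : Integrable (fun p : EuclideanSpace ℝ (ι ⊕ κ) × EuclideanSpace ℝ ι =>
      modelIntegrand ν ν' (spherical (ι ⊕ κ) ν) (spherical ι ν') p.1 p.2) := by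
    rw [Measure.volume_eq_prod,
      integrable_prod_iff' (measurable_modelIntegrand_spherical ν ν').aestronglyMeasurable]
    simp only [hmi]
    refine ⟨Filter.Eventually.of_forall fun y => (hK y).1.mul_const _, ?_⟩
    simp only [norm_mul, integral_mul_const, (hK _).2.2]
    -- The factors in `y` have to be merged inside the norm before the parameter-free integral
    -- applies.
    simp only [mul_right_comm, ← norm_mul, hexp]
    exact (integral_japanese_self ι).1.norm.mul_const _
  refine ⟨hint, ?_⟩
  rw [modelIntegral, integral_integral_swap hint]
  simp only [hmi, integral_mul_const, (hK _).2.1]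
  simp only [mul_right_comm, hexp, integral_mul_const]
  rw [(integral_japanese_self ι).2, hG.2, specialValue]
  have hpi : (Real.pi : ℂ) ≠ 0 := by exact_mod_cast Real.pi_ne_zero
  have e1 : (Real.pi : ℂ) ^ ((rho (Fintype.card (ι ⊕ κ) + 1) : ℂ) + rho (Fintype.card ι + 1))
      = (Real.pi : ℂ) ^ ((Fintype.card ι : ℂ) / 2) * ((Real.pi : ℂ) ^ ((Fintype.card ι : ℂ) / 2) *
        (Real.pi : ℂ) ^ ((Fintype.card κ : ℂ) / 2)) := by
    rw [← Complex.cpow_add _ _ hpi, ← Complex.cpow_add _ _ hpi, rho_card_add_one,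
      rho_card_add_one, Fintype.card_sum]
    congr 1; push_cast; ring
  have e2 : (ν + rho (Fintype.card (ι ⊕ κ) + 1) + (ν' - rho (Fintype.card ι + 1))) / 2
      = s - Fintype.card ι / 2 - (b + Fintype.card κ) / 2 := by
    rw [hs', hb', rho_card_add_one, rho_card_add_one, Fintype.card_sum]; push_cast; ring
  have e3 : (ν + rho (Fintype.card (ι ⊕ κ) + 1) - (ν' + rho (Fintype.card ι + 1))) / 2
      = (b + Fintype.card κ) / 2 := by
    rw [hb', rho_card_add_one, rho_card_add_one, Fintype.card_sum]; push_cast; ring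
  have e4 : (rho (Fintype.card (ι ⊕ κ) + 1) : ℂ) - rho (Fintype.card ι + 1)
      = (Fintype.card κ : ℂ) / 2 := by
    rw [rho_card_add_one, rho_card_add_one, Fintype.card_sum]; push_cast; ring
  rw [e1, e2, e3, e4, ← hs]
  simp only [div_eq_mul_inv, mul_inv]
  ring

end Convergence

end ModelForm

/-! ### The formula and non-triviality. -/

theorem mainTheorem3 (n m : ℕ) (hm : 0 < m) (hmn : m < n) :
    -- on the region of convergence
    (∀ ν ν' : ℂ, (ν, ν') ∈ ModelForm.convRegion (Fin (m - 1)) (Fin (n - m)) →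
      MeasureTheory.Integrable
        (fun p : EuclideanSpace ℝ (Fin (m - 1) ⊕ Fin (n - m)) × EuclideanSpace ℝ (Fin (m - 1)) =>
          ModelForm.modelIntegrand ν ν' (ModelForm.spherical (Fin (m - 1) ⊕ Fin (n - m)) ν)
            (ModelForm.spherical (Fin (m - 1)) ν') p.1 p.2) ∧
      ModelForm.modelIntegral ν ν' (ModelForm.spherical (Fin (m - 1) ⊕ Fin (n - m)) ν)
          (ModelForm.spherical (Fin (m - 1)) ν')
        = ModelForm.specialValue n m ν ν') ∧
    -- the identity of meromorphic functions on `ℂ²`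
    ModelForm.IsMeromorphic (fun p : ℂ × ℂ =>
      ModelForm.modelForm p.1 p.2 (ModelForm.spherical (Fin (m - 1) ⊕ Fin (n - m)) p.1)
        (ModelForm.spherical (Fin (m - 1)) p.2)) ∧
    ModelForm.IsMeromorphic (fun p : ℂ × ℂ => ModelForm.specialValue n m p.1 p.2) ∧
    (∀ ν ν' : ℂ, ModelForm.IsRegular n m ν ν' →
      ModelForm.modelForm ν ν' (ModelForm.spherical (Fin (m - 1) ⊕ Fin (n - m)) ν)
          (ModelForm.spherical (Fin (m - 1)) ν')
        = ModelForm.specialValue n m ν ν') ∧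
    -- non-triviality of the form on `J(ν) × J'(ν')`
    (∀ ν ν' : ℂ, ModelForm.IsUnitaryParam (ModelForm.rho n) ν →
      ModelForm.IsUnitaryParam (ModelForm.rho m) ν' → ModelForm.IsRegular n m ν ν' →
      ∃ f₁ ∈ ModelForm.flatRep (Fin (m - 1) ⊕ Fin (n - m)) ν,
        ∃ f₂ ∈ ModelForm.flatRep (Fin (m - 1)) ν',
          ModelForm.modelForm ν ν' f₁ f₂ ≠ 0) := by
  have hcm : Fintype.card (Fin (m - 1)) + 1 = m := by rw [Fintype.card_fin]; omega
  have hcn : Fintype.card (Fin (m - 1) ⊕ Fin (n - m)) + 1 = n := by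
    rw [Fintype.card_sum, Fintype.card_fin, Fintype.card_fin]; omega
  have : Nonempty (Fin (n - m)) := ⟨⟨0, by omega⟩⟩
  have hconv : ∀ ν ν' : ℂ, (ν, ν') ∈ ModelForm.convRegion (Fin (m - 1)) (Fin (n - m)) → _ :=
    fun ν ν' h => ModelForm.modelIntegral_spherical h
  rw [hcm, hcn] at hconv
  have hval : ∀ ν ν' : ℂ, ModelForm.IsRegular n m ν ν' →
      ModelForm.modelForm ν ν' (ModelForm.spherical (Fin (m - 1) ⊕ Fin (n - m)) ν)
          (ModelForm.spherical (Fin (m - 1)) ν')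
        = ModelForm.specialValue n m ν ν' := fun ν ν' h =>
    ModelForm.modelForm_spherical_eq (ModelForm.isMeromorphic_specialValue n m)
      (fun p hp => (hconv p.1 p.2 hp).2) (ModelForm.analyticAt_specialValue h)
  refine ⟨hconv, ModelForm.isMeromorphic_of_eq_specialValue hval,
    ModelForm.isMeromorphic_specialValue n m, hval, fun ν ν' hν _ h => ?_⟩
  -- The spherical vectors themselves witness non-triviality.
  refine ⟨_, ModelForm.spherical_mem_flatRep ν, _, ModelForm.spherical_mem_flatRep ν', ?_⟩
  rw [hval ν ν' h]
  exact ModelForm.specialValue_ne_zero hm hmn hν h
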